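/- **Setting.** Let $\sigma(t)=\max(t,0)$. A ReLU network with input dimension $d$, output dimension $K$, depth $D$ (number of hidden layers) and hidden layer sizes $p_1,\dots,p_D$ computes $\phi:\mathbb R^d\to\mathbb R^K$, $$\phi_0(x)=x,\quad \phi_{i+1}(x)=\sigma(W_i\phi_i(x)+b_i)\ (0\le i<D),\quad \phi(x)=W_D\phi_D(x)+b_D;$$ its width is $\max_i p_i$. For a real number $R$ let $\mathcal F_{d,K}(W,D,R)$ be the set of functions computed by such networks of width $W$ and depth $D$ with $\|(W_D,b_D)\|\prod_{i<D}\max\{\|(W_i,b_i)\|,1\}\le R$, where $\|\cdot\|$ is the largest $\ell^1$-norm of a row. For $\tau=r+\nu$ with $r\in\mathbb N$, $\nu\in(0,1]$, let $\mathcal C_{\tau,s,K,B}$ be the set of maps $g=(g_1,\dots,g_K):[0,1]^s\to\mathbb R^K$ with $g_i\in C^r([0,1]^s)$, $|\partial^\alpha g_i|\le B$ for $|\alpha|\le r$, and $|\partial^\alpha g_i(x)-\partial^\alpha g_i(y)|\le B|x-y|^\nu$ for $|\alpha|=r$, for all $i$ and all $x,y\in[0,1]^s$. Let $1\le s<d$,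 $C\ge1$, and let $\mathcal A\subset\mathbb R^d$ be a compact smooth embedded $s$-dimensional submanifold, possibly with boundary and corners, with the metric induced from $\mathbb R^d$; $L^2(\mathcal A)$ is taken with respect to the $s$-dimensional Hausdorff measure (the Riemannian volume up to a constant factor). Let $\mathcal A=\bigcup_{j=1}^CU_j$, and let $\zeta_j:\mathbb R^d\to\mathbb R^s$ be linear maps such that $\zeta_j$ maps $U_j$ bijectively onto $[0,1]^s$; $\zeta_j^{-1}:[0,1]^s\to U_j$ denotes the inverse. Let $S_j$ be a compact subset of the interior of $U_j$ relative to $\mathcal A$ (if $U_j$ is compact and relatively open in $\mathcal A$, one may take $S_j=U_j$, and the support condition below is void). **Theorem.** Given $s$, $\tau=r+\nu$ and $B'$, there are constants $c_1,c_2>0$, depending only on these, such that for all $d,C,\mathcal A,(U_j),(\zeta_j),(S_j)$ as above there is a constant $c_3>0$ such that for every $K\in\mathbb N$ there is $M_0>0$ for which the following holds. Let $\kappa_j:U_j\to\mathbb R^K$ $(1\le j\le C)$ satisfy $\kappa_j\circ\zeta_j^{-1}\in\mathcal C_{\tau,s,K,B'}$ and $\kappa_j=0$ on $U_j\setminus S_j$,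 and let $\kappa=\sum_{j=1}^C\kappa_j$ on $\mathcal A$, where each $\kappa_j$ is extended by $0$ outside $U_j$. Then for every real $M\ge M_0$ and all $W,D\in\mathbb N$ with $$W\ge c_1\,C\,M^{s/(s+1)}\log M,\qquad D\ge c_2\log M,$$ there is $f\in\mathcal F_{d,K}(W,D,CM)$ with $$\|f-\kappa\|_{L^2(\mathcal A)}\le c_3\sqrt K\,M^{-\tau/(s+1)}.$$ -/

import Mathlib

open MeasureTheory Set Topology
open scoped ContDiff

/-! ### ReLU networks -/

/-- A fully connected ReLU network with input dimension the index `d` and output dimension `K`,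
given by its weight matrices and bias vectors, from the input to the output:
`φ₀(x) = x`, `φᵢ₊₁(x) = σ(Wᵢ φᵢ(x) + bᵢ)`, and the last layer is affine without activation. -/
inductive ReLUNet (K : ℕ) : ℕ → Type
  | output {d : ℕ} (A : Matrix (Fin K) (Fin d) ℝ) (b : Fin K → ℝ) : ReLUNet K d
  | hidden {d p : ℕ} (A : Matrix (Fin p) (Fin d) ℝ) (b : Fin p → ℝ) (N : ReLUNet K p) :
      ReLUNet K d

/-- The norm of the augmented matrix `(A, b)`: the largest `ℓ¹`-norm of one of its rows. -/
noncomputable def layerNorm {m n : ℕ} (A : Matrix (Fin m) (Fin n) ℝ) (b : Fin m → ℝ) : ℝ :=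
  ⨆ i : Fin m, ((∑ j : Fin n, |A i j|) + |b i|)

namespace ReLUNet

/-- The function computed by the network. -/
noncomputable def eval {K : ℕ} : {d : ℕ} → ReLUNet K d → (Fin d → ℝ) → (Fin K → ℝ)
  | _, output A b, x => A.mulVec x + b
  | _, hidden A b N, x => N.eval (fun i => max ((A.mulVec x + b) i) 0)

/-- The depth: the number of hidden layers. -/
def depth {K : ℕ} : {d : ℕ} → ReLUNet K d → ℕ
  | _, output _ _ => 0
  | _, hidden _ _ N => N.depth + 1

/-- The width: the largest number of neurons in a hidden layer. -/
def width {K : ℕ} : {d : ℕ} → ReLUNet K d → ℕ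
  | _, output _ _ => 0
  | _, @hidden _ _ p _ _ N => max p N.width

/-- `‖(W_D, b_D)‖ ∏_{i < D} max (‖(W_i, b_i)‖, 1)`. -/
noncomputable def normProd {K : ℕ} : {d : ℕ} → ReLUNet K d → ℝ
  | _, output A b => layerNorm A b
  | _, hidden A b N => max (layerNorm A b) 1 * N.normProd

end ReLUNet

/-- The norm-constrained class `𝓕_{d,K}(W, D, M)` of functions computed by ReLU networks of width
`W` and depth `D` whose product of layer norms is at most `M`. -/
def reluClass (d K W D : ℕ) (M : ℝ) :
    Set (EuclideanSpace ℝ (Fin d) → EuclideanSpace ℝ (Fin K)) :=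
  {f | ∃ N : ReLUNet K d, N.width = W ∧ N.depth = D ∧ N.normProd ≤ M ∧
    ∀ x, f x = WithLp.toLp 2 (N.eval (WithLp.ofLp x))}

/-! ### Hölder classes on the unit cube -/

/-- The closed unit cube `[0,1]^s`. -/
def unitCube (s : ℕ) : Set (EuclideanSpace ℝ (Fin s)) :=
  {y | ∀ i, y i ∈ Set.Icc (0 : ℝ) 1}

/-- The iterated partial derivative `∂_{t 0} ⋯ ∂_{t (k-1)} g (y)` of a function on the closed unit
cube (one-sided at the boundary). The multi-indices `α` of order `k` are listed by the tuples `t`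
of `k` coordinate directions. -/
noncomputable def cubePartial {s k : ℕ} (t : Fin k → Fin s)
    (g : EuclideanSpace ℝ (Fin s) → ℝ) (y : EuclideanSpace ℝ (Fin s)) : ℝ :=
  iteratedFDerivWithin ℝ k g (unitCube s) y (fun i => EuclideanSpace.single (t i) (1 : ℝ))

/-- The class `𝓒_{τ,s,K,B}` with `τ = r + ν`: all components are `C^r` on `[0,1]^s`, with partial
derivatives up to order `r` bounded by `B`, and those of order `r` Hölder continuous with exponent
`ν` and constant `B`. Only the values on the cube matter. -/
def holderClass (r : ℕ) (ν : ℝ) (s K : ℕ) (B : ℝ) :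
    Set (EuclideanSpace ℝ (Fin s) → EuclideanSpace ℝ (Fin K)) :=
  {F | ∀ i : Fin K,
    ContDiffOn ℝ r (fun y => F y i) (unitCube s) ∧
    (∀ k ≤ r, ∀ t : Fin k → Fin s, ∀ y ∈ unitCube s, |cubePartial t (fun z => F z i) y| ≤ B) ∧
    (∀ t : Fin r → Fin s, ∀ y ∈ unitCube s, ∀ z ∈ unitCube s,
      |cubePartial t (fun w => F w i) y - cubePartial t (fun w => F w i) z| ≤ B * ‖y - z‖ ^ ν)}

/-! ### Embedded manifolds with linear charts -/

/-- `A` is a smooth embedded `s`-dimensional submanifold of `ℝ^d`, possibly with boundary and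
corners: near each of its points a smooth diffeomorphism of open sets carries `A` to
`[0,∞)^s × {0}`. It carries the Riemannian metric induced from `ℝ^d`. -/
def IsEmbeddedManifold (d s : ℕ) (A : Set (EuclideanSpace ℝ (Fin d))) : Prop :=
  ∀ p ∈ A, ∃ Φ : OpenPartialHomeomorph (EuclideanSpace ℝ (Fin d))
      (EuclideanSpace ℝ (Fin s) × EuclideanSpace ℝ (Fin (d - s))),
    p ∈ Φ.source ∧ ContDiffOn ℝ ∞ Φ Φ.source ∧ ContDiffOn ℝ ∞ Φ.symm Φ.target ∧
    ∀ x ∈ Φ.source, x ∈ A ↔ (∀ i, 0 ≤ (Φ x).1 i) ∧ (Φ x).2 = 0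

/-- `A` is a compact embedded `s`-dimensional manifold which is the union of the sets `U j`, and
the linear map `ζ j` maps `U j` bijectively onto `[0,1]^s`. -/
structure IsLinearlyCharted {d s C : ℕ} (A : Set (EuclideanSpace ℝ (Fin d)))
    (U : Fin C → Set (EuclideanSpace ℝ (Fin d)))
    (ζ : Fin C → EuclideanSpace ℝ (Fin d) →ₗ[ℝ] EuclideanSpace ℝ (Fin s)) : Prop where
  isCompact : IsCompact A
  isEmbeddedManifold : IsEmbeddedManifold d s A
  eq_iUnion : A = ⋃ j, U j
  bijOn : ∀ j, Set.BijOn (ζ j) (U j) (unitCube s)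

/-- The interior of `V` relative to `A`. -/
def relInterior {X : Type*} [TopologicalSpace X] (A V : Set X) : Set X :=
  {x ∈ A | V ∈ 𝓝[A] x}

/-! On one chart, $g=\kappa_j\circ\zeta_j^{-1}$ is replaced by its Taylor polynomials at the points
of the grid $\{0,1/N,\dots,1\}^s$, glued by a partition of unity subordinate to the grid; the Hölder
remainder is $O(N^{-\tau})$. The partition of unity is made of nodal functions of the Freudenthal
triangulation, which are built from maxima and hence are exactly networks of fixed size
(`sum_nodal_eq_one`). Products with monomials come from a sawtooth approximation of the square with
error $4^{-n}$, $n\sim\log N$, at norm cost only linear in $n$ (`normNet_sqApprox`).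

To localize on the manifold, each weight is lowered by a cutoff $\eta_j$ before a final ReLU. As
$\eta_j=0$ on $S_j$ and $\eta_j=1$ on $\mathcal A\setminus U_j$, the weights are untouched on $S_j$
and vanish off $U_j$. On $U_j\setminus S_j$ they are uncontrolled, but there $\kappa_j=0$ and their
sum is at most $1$, so the Taylor bound survives (`abs_sum_nodeWeight_taylor_sub_le`). Cutoffs and
charts form an input network of fixed size, whose norm enters only $c_3$.

The norm budget fixes the rate: zooming to a grid cell costs $N$, summing over the grid costs
$(N+1)^s$, and a degree $k$ monomial costs $n^k$, absorbed by its factor $N^{-k}$ as $n\le N$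
(`exists_normNet_gridApprox`). Hence $M\sim N^{s+1}$ and the error is $M^{-\tau/(s+1)}$. The $K$
outputs share all features and the norm is a maximum over rows, so $K$ affects neither width nor
norm. -/

/-! ### Calculus of networks whose hidden layers have norm at most one -/

/-- `φ` is computed by a ReLU network with `L` hidden layers of width at most `w`, whose hidden
layers have norm at most `1` and whose output layer has norm at most `R`. The neurons of a layer
may be indexed by any finite type. -/
def NormNet {ι : Type} (w : ℕ) (R : ℝ) :
    ℕ → ∀ {κ : Type} [Fintype κ], ((κ → ℝ) → (ι → ℝ)) → Prop
  | 0, κ, _, φ => ∃ (A : ι → κ → ℝ) (b : ι → ℝ), (∀ i, ∑ j, |A i j| + |b i| ≤ R) ∧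
      ∀ x i, φ x i = ∑ j, A i j * x j + b i
  | L + 1, κ, _, φ => ∃ (p : Type) (_ : Fintype p) (A : p → κ → ℝ) (b : p → ℝ)
      (N : (p → ℝ) → (ι → ℝ)), Fintype.card p ≤ w ∧ (∀ i, ∑ j, |A i j| + |b i| ≤ 1) ∧
      NormNet w R L N ∧ ∀ x, φ x = N (fun i => max (∑ j, A i j * x j + b i) 0)

namespace NormNet

variable {ι κ : Type} [Fintype κ] {w w' L L' : ℕ} {R R' : ℝ}

theorem mono (hw : w ≤ w') (hR : R ≤ R') {φ : (κ → ℝ) → (ι → ℝ)} (h : NormNet w R L φ) :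
    NormNet w' R' L φ := by
  induction L generalizing κ with
  | zero =>
    obtain ⟨A, b, h1, h2⟩ := h
    exact ⟨A, b, fun i => (h1 i).trans hR, h2⟩
  | succ L ih =>
    obtain ⟨p, _, A, b, N, h1, h2, h3, h4⟩ := h
    exact ⟨p, _, A, b, N, h1.trans hw, h2, ih h3, h4⟩

/-- By positive homogeneity of ReLU, a factor $c\ge1$ moves through the hidden layers to the output
layer; on the way the biases only shrink. This lets all the norm be collected in the output layer.
-/
theorem prescale {c : ℝ} (hc : 1 ≤ c) {φ : (κ → ℝ) → (ι → ℝ)} (h : NormNet w R L φ) :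
    NormNet w (c * R) L (fun x => φ (fun i => c * x i)) := by
  have hc0 : 0 < c := by linarith
  induction L generalizing κ with
  | zero =>
    obtain ⟨A, b, h1, h2⟩ := h
    refine ⟨fun i j => c * A i j, b, fun i => ?_, fun x i => ?_⟩
    · simp only [abs_mul, abs_of_pos hc0, ← Finset.mul_sum]
      nlinarith [h1 i, abs_nonneg (b i)]
    · simp only [h2]
      congr 1
      exact Finset.sum_congr rfl fun j _ => by ring
  | succ L ih =>
    obtain ⟨p, _, A, b, N, h1, h2, h3, h4⟩ := h
    refine ⟨p, _, A, fun i => c⁻¹ * b i, _, h1, fun i => ?_, ih h3, fun x => ?_⟩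
    · have : |c⁻¹ * b i| ≤ |b i| := by
        rw [abs_mul, abs_of_pos (inv_pos.2 hc0)]
        exact mul_le_of_le_one_left (abs_nonneg _) (inv_le_one_of_one_le₀ hc)
      linarith [h2 i]
    · simp only [h4]
      congr 1
      ext i
      rw [mul_max_of_nonneg _ _ hc0.le, mul_zero]
      congr 1
      rw [mul_add, Finset.mul_sum, mul_inv_cancel_left₀ hc0.ne']
      congr 1
      exact Finset.sum_congr rfl fun j _ => by ring

theorem affine_comp_norm_le {μ : Type} [Fintype μ] (a : μ → ℝ) (β : ℝ) (A : μ → κ → ℝ) (b : μ → ℝ)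
    (hA : ∀ k, ∑ j, |A k j| + |b k| ≤ R) :
    ∑ j, |∑ k, a k * A k j| + |∑ k, a k * b k + β| ≤ (∑ k, |a k|) * R + |β| := by
  have h1 : ∑ j, |∑ k, a k * A k j| ≤ ∑ k, |a k| * ∑ j, |A k j| := by
    simp only [Finset.mul_sum]
    rw [Finset.sum_comm]
    refine Finset.sum_le_sum fun j _ => (Finset.abs_sum_le_sum_abs _ _).trans ?_
    simp only [abs_mul, le_refl]
  have h2 : |∑ k, a k * b k + β| ≤ ∑ k, |a k| * |b k| + |β| := by
    refine (abs_add_le _ _).trans (add_le_add_left ((Finset.abs_sum_le_sum_abs _ _).trans ?_) _)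
    simp only [abs_mul, le_refl]
  have h3 : ∑ k, |a k| * ∑ j, |A k j| + ∑ k, |a k| * |b k| ≤ (∑ k, |a k|) * R := by
    rw [← Finset.sum_add_distrib, Finset.sum_mul]
    refine Finset.sum_le_sum fun k _ => ?_
    rw [← mul_add]
    exact mul_le_mul_of_nonneg_left (hA k) (abs_nonneg _)
  linarith

theorem affine_comp_apply {μ : Type} [Fintype μ] (a : μ → ℝ) (β : ℝ) (A : μ → κ → ℝ) (b : μ → ℝ)
    (x : κ → ℝ) :
    ∑ k, a k * (∑ j, A k j * x j + b k) + β =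
      ∑ j, (∑ k, a k * A k j) * x j + (∑ k, a k * b k + β) := by
  simp only [mul_add, Finset.sum_add_distrib, Finset.mul_sum, Finset.sum_mul]
  rw [Finset.sum_comm, add_assoc]
  congr 1
  exact Finset.sum_congr rfl fun j _ => Finset.sum_congr rfl fun k _ => by ring

theorem post_affine [Fintype ι] {o : Type} {φ : (κ → ℝ) → (ι → ℝ)} (h : NormNet w R L φ)
    (A : o → ι → ℝ) (b : o → ℝ) (hA : ∀ i, (∑ j, |A i j|) * R + |b i| ≤ R') :
    NormNet w R' L (fun x i => ∑ j, A i j * φ x j + b i) := by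
  induction L generalizing κ with
  | zero =>
    obtain ⟨A', b', h1, h2⟩ := h
    refine ⟨fun i j => ∑ k, A i k * A' k j, fun i => ∑ k, A i k * b' k + b i, fun i =>
      (affine_comp_norm_le _ _ _ _ h1).trans (hA i), fun x i => ?_⟩
    simp only [h2, affine_comp_apply]
  | succ L ih =>
    obtain ⟨p, _, A', b', N, h1, h2, h3, h4⟩ := h
    exact ⟨p, _, A', b', _, h1, h2, ih h3, fun x => by simp only [h4]⟩

/-- The output layer of `φ` merges with the first layer of `F`. Dividing the merged layer by `R`
keeps its norm at most `1`, and `prescale` pays the factor `R` at the output. -/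
theorem comp [Fintype ι] {o : Type} {φ : (κ → ℝ) → (ι → ℝ)} {F : (ι → ℝ) → (o → ℝ)}
    (h : NormNet w R L φ) (hF : NormNet w R' L' F) (hR : 1 ≤ R) :
    NormNet w (R * R') (L' + L) (fun x => F (φ x)) := by
  induction L generalizing κ with
  | zero =>
    cases L' with
    | zero =>
      obtain ⟨A, b, h1, h2⟩ := hF
      have := h.post_affine (R' := R * R') A b fun i => by
        nlinarith [h1 i, abs_nonneg (b i)]
      simpa only [← h2] using this
    | succ L' =>
      obtain ⟨p, _, A, b, N, h1, h2, h3, h4⟩ := hF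
      obtain ⟨A', b', h1', h2'⟩ := h
      have hR0 : 0 < R := by linarith
      refine ⟨p, _, fun i j => R⁻¹ * ∑ k, A i k * A' k j,
        fun i => R⁻¹ * (∑ k, A i k * b' k + b i), _, h1, fun i => ?_, h3.prescale hR, fun x => ?_⟩
      · simp only [abs_mul, ← Finset.mul_sum, ← mul_add, abs_of_pos (inv_pos.2 hR0)]
        rw [inv_mul_le_iff₀ hR0, mul_one]
        refine (affine_comp_norm_le _ _ _ _ h1').trans ?_
        nlinarith [h2 i, abs_nonneg (b i)]
      · simp only [h4]
        congr 1
        ext i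
        rw [mul_max_of_nonneg _ _ hR0.le, mul_zero, mul_add, mul_inv_cancel_left₀ hR0.ne',
          Finset.mul_sum]
        simp only [h2', affine_comp_apply, mul_assoc, mul_inv_cancel_left₀ hR0.ne']
  | succ L ih =>
    obtain ⟨p, _, A, b, N, h1, h2, h3, h4⟩ := h
    exact ⟨p, _, A, b, _, h1, h2, ih h3, fun x => by simp only [h4]⟩

theorem of_affine (w : ℕ) {φ : (κ → ℝ) → (ι → ℝ)} (A : ι → κ → ℝ) (b : ι → ℝ)
    (hA : ∀ i, ∑ j, |A i j| + |b i| ≤ R) (hφ : ∀ x i, φ x i = ∑ j, A i j * x j + b i) :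
    NormNet w R 0 φ := ⟨A, b, hA, hφ⟩

theorem select {μ : Type} [Fintype μ] {φ : (κ → ℝ) → (ι → ℝ)} (h : NormNet w R L φ) (f : κ → μ) :
    NormNet w R L (fun x : μ → ℝ => φ (fun i => x (f i))) := by
  classical
  have := (of_affine (R := 1) w (φ := fun (x : μ → ℝ) i => x (f i))
    (fun i j => if j = f i then 1 else 0) 0 (fun i => by simp [apply_ite abs])
    fun x i => by simp).comp h le_rfl
  simpa using this

theorem outputs [Fintype ι] {o : Type} {φ : (κ → ℝ) → (ι → ℝ)} (h : NormNet w R L φ) (f : o → ι) :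
    NormNet w R L (fun x i => φ x (f i)) := by
  classical
  have := h.post_affine (R' := R) (fun i j => if j = f i then 1 else 0) 0
    (fun i => by simp [apply_ite abs])
  simpa using this

/-- After a hidden layer all values are nonnegative, so an identity layer followed by ReLU changes
nothing. This needs one hidden layer to start from. -/
theorem succ_depth {φ : (κ → ℝ) → (ι → ℝ)} (h : NormNet w R (L + 1) φ) :
    NormNet w R (L + 2) φ := by
  classical
  induction L generalizing κ with
  | zero =>
    obtain ⟨p, _, A, b, N, h1, h2, h3, h4⟩ := h
    exact ⟨p, _, A, b, fun x => N (fun i => max (x i) 0), h1, h2,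
      ⟨p, _, fun i j => if j = i then 1 else 0, 0, N, h1, fun i => by simp [apply_ite abs], h3,
        fun x => by simp⟩, fun x => by simp [h4]⟩
  | succ L ih =>
    obtain ⟨p, _, A, b, N, h1, h2, h3, h4⟩ := h
    exact ⟨p, _, A, b, N, h1, h2, ih h3, h4⟩

theorem depth_mono {φ : (κ → ℝ) → (ι → ℝ)} (h : NormNet w R L φ) (hL : 0 < L) (hLL : L ≤ L') :
    NormNet w R L' φ := by
  induction L', hLL using Nat.le_induction with
  | base => exact h
  | succ n hn ih =>
    obtain ⟨k, rfl⟩ : ∃ k, n = k + 1 := ⟨n - 1, by omega⟩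
    exact ih.succ_depth

/-- Networks with a common input, run in parallel. -/
theorem parallel {J : Type} [Fintype J] {ι : J → Type} {w : J → ℕ}
    {φ : ∀ j, (κ → ℝ) → (ι j → ℝ)} (h : ∀ j, NormNet (w j) R L (φ j)) :
    NormNet (∑ j, w j) R L (fun x (q : Σ j, ι j) => φ q.1 x q.2) := by
  induction L generalizing κ with
  | zero =>
    choose A b h1 h2 using h
    exact ⟨fun q => A q.1 q.2, fun q => b q.1 q.2, fun q => h1 q.1 q.2, fun x q => h2 q.1 x q.2⟩
  | succ L ih =>
    choose p _ A b N h1 h2 h3 h4 using h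
    refine ⟨Σ j, p j, inferInstance, fun q => A q.1 q.2, fun q => b q.1 q.2, _, ?_,
      fun q => h2 q.1 q.2, ih fun j => (h3 j).select (Sigma.mk j), fun x => ?_⟩
    · rw [Fintype.card_sigma]
      exact Finset.sum_le_sum fun j _ => h1 j
    · simp only [h4]

theorem parallel_scalar {J : Type} [Fintype J] {w : J → ℕ} {f : J → (κ → ℝ) → ℝ}
    (h : ∀ j, NormNet (w j) R L (fun x (_ : Unit) => f j x)) :
    NormNet (∑ j, w j) R L (fun x j => f j x) :=
  (parallel h).outputs fun j => ⟨j, ()⟩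

theorem relu {f : (κ → ℝ) → ℝ} (h : NormNet w R L (fun x (_ : Unit) => f x)) (hw : 1 ≤ w)
    (hR : 1 ≤ R) : NormNet w R (L + 1) (fun x (_ : Unit) => max (f x) 0) := by
  have hid : NormNet w 1 0 (fun (x : Unit → ℝ) (_ : Unit) => x ()) :=
    of_affine w 1 0 (fun i => by simp) fun x i => by simp
  have hσ : NormNet w 1 1 (fun (x : Unit → ℝ) (_ : Unit) => max (x ()) 0) :=
    ⟨Unit, _, 1, 0, _, by simpa using hw, fun i => by simp, hid, fun x => by simp⟩
  have := h.comp hσ hR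
  rwa [mul_one, add_comm] at this

theorem abs {f : (κ → ℝ) → ℝ} (h : NormNet w R L (fun x (_ : Unit) => f x)) (hw : 2 ≤ w)
    (hR : 1 ≤ R) : NormNet w (2 * R) (L + 1) (fun x (_ : Unit) => |f x|) := by
  have hadd : NormNet w 2 0 (fun (x : Bool → ℝ) (_ : Unit) => x true + x false) :=
    of_affine w (fun _ _ => 1) 0 (fun i => by norm_num) fun x i => by simp
  have hσ : NormNet w 2 1 (fun (x : Unit → ℝ) (_ : Unit) => |x ()|) := by
    refine ⟨Bool, _, fun i _ => cond i 1 (-1), 0, _, by simpa using hw, fun i => ?_, hadd,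
      fun x => ?_⟩
    · cases i <;> simp
    · ext
      rcases le_total (x ()) 0 with h0 | h0
      · simp [h0, abs_of_nonpos h0]
      · simp [h0, abs_of_nonneg h0]
  have := h.comp hσ hR
  rwa [mul_comm, add_comm] at this

theorem sum {J : Type} [Fintype J] {w : J → ℕ} {f : J → (κ → ℝ) → ℝ}
    (h : ∀ j, NormNet (w j) R L (fun x (_ : Unit) => f j x)) (a : J → ℝ) (c : ℝ)
    (hR : (∑ j, |a j|) * R + |c| ≤ R') :
    NormNet (∑ j, w j) R' L (fun x (_ : Unit) => ∑ j, a j * f j x + c) :=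
  (parallel_scalar h).post_affine (fun _ => a) (fun _ => c) fun _ => hR

theorem smul {f : (κ → ℝ) → ℝ} (h : NormNet w R L (fun x (_ : Unit) => f x)) (a c : ℝ)
    (hR : |a| * R + |c| ≤ R') : NormNet w R' L (fun x (_ : Unit) => a * f x + c) := by
  simpa using h.post_affine (R' := R') (fun _ _ => a) (fun (_ : Unit) => c) (by simpa using hR)

/-- A realization by a `ReLUNet` of prescribed width. -/
theorem exists_reLUNet {K d : ℕ} (hR : 0 ≤ R) (hL : 0 < L) {φ : (Fin d → ℝ) → (Fin K → ℝ)}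
    (h : NormNet w R L φ) :
    ∃ N : ReLUNet K d, N.width = w ∧ N.depth = L ∧ N.normProd ≤ R ∧ ∀ x, φ x = N.eval x := by
  have key : ∀ L d (φ : (Fin d → ℝ) → (Fin K → ℝ)), NormNet w R L φ →
      ∃ N : ReLUNet K d, (N.width ≤ w ∧ (0 < L → N.width = w)) ∧ N.depth = L ∧ N.normProd ≤ R ∧
        ∀ x, φ x = N.eval x := by
    intro L
    induction L with
    | zero =>
      rintro d φ ⟨A, b, h1, h2⟩
      refine ⟨.output A b, ⟨by simp [ReLUNet.width], by simp⟩, rfl, ?_, fun x => ?_⟩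
      · exact Real.iSup_le h1 hR
      · ext i
        simp [ReLUNet.eval, Matrix.mulVec, dotProduct, h2]
    | succ L ih =>
      rintro d φ ⟨p, _, A, b, N, h1, h2, h3, h4⟩
      obtain ⟨e⟩ : Nonempty (p ↪ Fin w) :=
        Function.Embedding.nonempty_of_card_le (by simpa using h1)
      obtain ⟨N', ⟨hw, -⟩, hd, hn, he⟩ := ih w _ (h3.select e)
      -- Zero neurons pad every hidden layer to width exactly `w`.
      refine ⟨.hidden (Function.extend e A 0) (Function.extend e b 0) N', ?_, ?_, ?_, fun x => ?_⟩
      · simp [ReLUNet.width, hw]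
      · simp [ReLUNet.depth, hd]
      · have : layerNorm (Function.extend e A 0) (Function.extend e b 0) ≤ 1 := by
          refine Real.iSup_le (fun i => ?_) zero_le_one
          by_cases hi : ∃ q, e q = i
          · obtain ⟨q, rfl⟩ := hi
            simpa [e.injective.extend_apply] using h2 q
          · simp [Function.extend_apply' _ _ _ hi]
        simpa [ReLUNet.normProd, max_eq_right this] using hn
      · simp only [ReLUNet.eval, h4, ← he]
        congr 1
        ext q
        simp [Matrix.mulVec, dotProduct, e.injective.extend_apply]
  obtain ⟨N, ⟨-, h1⟩, h2⟩ := key L d φ h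
  exact ⟨N, h1 hL, h2⟩

end NormNet

/-! ### Functions computed by networks of unspecified size -/

/-- A function computed by some ReLU network. -/
def IsNetFun {κ : Type} [Fintype κ] (f : (κ → ℝ) → ℝ) : Prop :=
  ∃ (w : ℕ) (R : ℝ) (L : ℕ), NormNet w R L (fun x (_ : Unit) => f x)

namespace IsNetFun

variable {κ : Type} [Fintype κ] {f g : (κ → ℝ) → ℝ}

theorem coord (i : κ) : IsNetFun (fun x : κ → ℝ => x i) := by
  classical
  exact ⟨0, 1, 0, NormNet.of_affine 0 (fun _ j => if j = i then 1 else 0) 0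
    (fun i => by simp [apply_ite abs]) fun x i => by simp⟩

theorem const (c : ℝ) : IsNetFun (fun _ : κ → ℝ => c) :=
  ⟨0, |c|, 0, NormNet.of_affine 0 0 (fun _ => c) (by simp) fun x i => by simp⟩

theorem relu (hf : IsNetFun f) : IsNetFun (fun x => max (f x) 0) := by
  obtain ⟨w, R, L, h⟩ := hf
  exact ⟨_, _, _, (h.mono (le_max_left w 1) (le_max_left R 1)).relu (le_max_right _ _)
    (le_max_right _ _)⟩

theorem smul (c : ℝ) (hf : IsNetFun f) : IsNetFun (fun x => c * f x) := by
  obtain ⟨w, R, L, h⟩ := hf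
  exact ⟨w, _, L, by simpa using h.smul c 0 le_rfl⟩

/-- The identity $t=\sigma(t)-\sigma(-t)$ adds a hidden layer, after which `depth_mono` applies. -/
theorem exists_pos_depth (hf : IsNetFun f) :
    ∃ w R L, 1 ≤ R ∧ 0 < L ∧ NormNet w R L (fun x (_ : Unit) => f x) := by
  classical
  obtain ⟨w, R, L, h⟩ := hf
  have h' := h.mono (le_max_left w 2) (le_max_left R 1)
  have hid : NormNet (max w 2) 2 1 (fun (x : Unit → ℝ) (_ : Unit) => x ()) := by
    have hsub : NormNet (max w 2) 2 0 (fun (x : Bool → ℝ) (_ : Unit) => x true - x false) :=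
      NormNet.of_affine _ (fun _ i => cond i 1 (-1)) 0 (fun i => by norm_num)
        fun x i => by simp [sub_eq_add_neg]
    refine ⟨Bool, _, fun i _ => cond i 1 (-1), 0, _, by simp, fun i => ?_, hsub, fun x => ?_⟩
    · cases i <;> simp
    · ext
      rcases le_total (x ()) 0 with h0 | h0 <;> simp [h0]
  refine ⟨_, _, _, ?_, ?_, h'.comp hid (le_max_right _ _)⟩
  · nlinarith [le_max_right R 1]
  · omega

theorem add (hf : IsNetFun f) (hg : IsNetFun g) : IsNetFun (fun x => f x + g x) := by
  obtain ⟨w, R, L, -, hL, h⟩ := hf.exists_pos_depth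
  obtain ⟨w', R', L', -, hL', h'⟩ := hg.exists_pos_depth
  have := NormNet.sum (J := Bool) (w := fun _ => max w w') (f := fun b => cond b f g)
    (R := max R R') (L := max L L') (fun b => ?_) 1 0 le_rfl
  · exact ⟨_, _, _, by simpa using this⟩
  · cases b
    · exact (h'.mono (le_max_right _ _) (le_max_right _ _)).depth_mono hL' (le_max_right _ _)
    · exact (h.mono (le_max_left _ _) (le_max_left _ _)).depth_mono hL (le_max_left _ _)

theorem sub (hf : IsNetFun f) (hg : IsNetFun g) : IsNetFun (fun x => f x - g x) := by
  simpa [sub_eq_add_neg] using hf.add (hg.smul (-1))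

theorem sum {J : Type} (s : Finset J) {f : J → (κ → ℝ) → ℝ} (h : ∀ j, IsNetFun (f j)) :
    IsNetFun (fun x => ∑ j ∈ s, f j x) := by
  classical
  induction s using Finset.induction_on with
  | empty => simpa using const 0
  | insert a s ha ih => simpa [Finset.sum_insert ha] using (h a).add ih

theorem sup (hf : IsNetFun f) (hg : IsNetFun g) : IsNetFun (fun x => max (f x) (g x)) := by
  have := hf.add (hg.sub hf).relu
  convert this using 2 with x
  rcases le_total (f x) (g x) with h | h <;> simp [h]

theorem foldr_max (l : List κ) (a : ℝ) :
    IsNetFun (fun x : κ → ℝ => l.foldr (fun i r => max (a * x i) r) 0) := by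
  induction l with
  | nil => exact const 0
  | cons i l ih => exact ((coord i).smul a).sup ih

theorem select {μ : Type} [Fintype μ] (hf : IsNetFun f) (e : κ → μ) :
    IsNetFun (fun x : μ → ℝ => f (fun i => x (e i))) := by
  obtain ⟨w, R, L, h⟩ := hf
  exact ⟨w, R, L, h.select e⟩

end IsNetFun

/-! ### The Freudenthal partition of unity -/

/-- The piecewise linear nodal function at the origin of the Freudenthal triangulation. -/
noncomputable def nodal {s : ℕ} (y : Fin s → ℝ) : ℝ :=
  max (1 - (List.finRange s).foldr (fun i r => max (1 * y i) r) 0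
    - (List.finRange s).foldr (fun i r => max (-1 * y i) r) 0) 0

theorem isNetFun_nodal (s : ℕ) : IsNetFun (nodal (s := s)) :=
  (((IsNetFun.const 1).sub (IsNetFun.foldr_max _ _)).sub (IsNetFun.foldr_max _ _)).relu

theorem foldr_max_le_iff {κ : Type} (l : List κ) (g : κ → ℝ) (c : ℝ) :
    l.foldr (fun i r => max (g i) r) 0 ≤ c ↔ 0 ≤ c ∧ ∀ i ∈ l, g i ≤ c := by
  induction l with
  | nil => simp
  | cons i l ih => simp [ih]; tauto

theorem nodal_nonneg {s : ℕ} (y : Fin s → ℝ) : 0 ≤ nodal y := le_max_right _ _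

theorem abs_lt_one_of_nodal_ne_zero {s : ℕ} {y : Fin s → ℝ} (h : nodal y ≠ 0) (i : Fin s) :
    |y i| < 1 := by
  unfold nodal at h
  have h1 := (foldr_max_le_iff (List.finRange s) (fun i => 1 * y i) _).1 le_rfl
  have h2 := (foldr_max_le_iff (List.finRange s) (fun i => -1 * y i) _).1 le_rfl
  have h3 := h1.2 i (by simp)
  have h4 := h2.2 i (by simp)
  rw [ne_eq, max_eq_right_iff, not_le] at h
  rw [abs_lt]
  constructor <;> linarith [h1.1, h2.1]

/-- Rounding the coordinates with a common random threshold `u` gives the nodal functions as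
probabilities. -/
theorem nodal_eq_volume {s : ℕ} (y : Fin s → ℝ) :
    nodal y = volume.real {u ∈ Ico (0 : ℝ) 1 | ∀ i, ⌈y i - u⌉ = 0} := by
  set a := (List.finRange s).foldr (fun i r => max (1 * y i) r) 0 with ha
  set b := (List.finRange s).foldr (fun i r => max (-1 * y i) r) 0 with hb
  -- The condition says $y_i\le u<y_i+1$ for all $i$; with $0\le u<1$ this is an interval, possibly
  -- empty.
  have : {u ∈ Ico (0 : ℝ) 1 | ∀ i, ⌈y i - u⌉ = 0} = Ico a (1 - b) := by
    ext u
    have h1 := foldr_max_le_iff (List.finRange s) (fun i => 1 * y i) u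
    have hb' : b < 1 - u ↔ 0 < 1 - u ∧ ∀ i, -1 * y i < 1 - u := by
      rw [hb]
      generalize 1 - u = c
      have : ∀ l : List (Fin s), l.foldr (fun i r => max (-1 * y i) r) 0 < c ↔
          0 < c ∧ ∀ i ∈ l, -1 * y i < c := by
        intro l
        induction l with
        | nil => simp
        | cons i l ih => simp only [List.foldr_cons, max_lt_iff, ih, List.mem_cons,
            forall_eq_or_imp]; tauto
      simpa using this (List.finRange s)
    rw [← ha] at h1
    have h2 : u < 1 - b ↔ b < 1 - u := by constructor <;> intro h <;> linarith
    simp only [mem_ofPred_eq, mem_Ico, h1, h2, hb', Int.ceil_eq_iff, Int.cast_zero]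
    simp only [List.mem_finRange, true_imp_iff]
    constructor
    · rintro ⟨⟨h3, h4⟩, h5⟩
      exact ⟨⟨h3, fun i => by linarith [(h5 i).2]⟩, by linarith, fun i => by linarith [(h5 i).1]⟩
    · rintro ⟨⟨h3, h4⟩, h5, h6⟩
      exact ⟨⟨h3, by linarith⟩, fun i => ⟨by linarith [h6 i], by linarith [h4 i]⟩⟩
  rw [this, Real.volume_real_Ico, nodal]
  congr 1
  ring

/-- Every threshold $u\in[0,1)$ rounds $x$ to exactly one grid point $\lceil x-u\rceil$ of
$\{0,\dots,N\}^s$, so the probabilities in `nodal_eq_volume` add up to one. -/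
theorem sum_nodal_eq_one {s N : ℕ} {x : Fin s → ℝ} (hx : ∀ i, x i ∈ Icc (0 : ℝ) N) :
    ∑ m : Fin s → Fin (N + 1), nodal (fun i => x i - (m i : ℕ)) = 1 := by
  simp only [nodal_eq_volume]
  rw [← measureReal_iUnion_fintype _ _ fun m =>
    ((measure_mono (sep_subset _ _)).trans_lt measure_Ico_lt_top).ne]
  · have : (⋃ m : Fin s → Fin (N + 1),
        {u ∈ Ico (0 : ℝ) 1 | ∀ i, ⌈x i - (m i : ℕ) - u⌉ = 0}) = Ico 0 1 := by
      ext u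
      simp only [mem_iUnion, mem_ofPred_eq, exists_and_left, and_iff_left_iff_imp]
      intro hu
      have h1 : ∀ i, ∃ k : Fin (N + 1), ⌈x i - u⌉ = (k : ℕ) := by
        intro i
        have h2 : 0 ≤ ⌈x i - u⌉ := by
          have : -1 < ⌈x i - u⌉ := by rw [Int.lt_ceil]; push_cast; linarith [(hx i).1, hu.2]
          omega
        have h3 : ⌈x i - u⌉ ≤ N := by
          rw [Int.ceil_le]; push_cast; linarith [(hx i).2, hu.1]
        exact ⟨⟨⌈x i - u⌉.toNat, by omega⟩, by simp [h2]⟩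
      choose m hm using h1
      refine ⟨m, fun i => ?_⟩
      rw [sub_right_comm, Int.ceil_sub_natCast, hm, sub_self]
    rw [this]
    simp
  · intro m m' hm
    refine Set.disjoint_left.2 fun u hu hu' => hm ?_
    ext i
    have h1 := hu.2 i
    have h2 := hu'.2 i
    rw [sub_right_comm, Int.ceil_sub_natCast] at h1 h2
    omega
  · intro m
    have : {u ∈ Ico (0 : ℝ) 1 | ∀ i, ⌈x i - (m i : ℕ) - u⌉ = 0} =
        Ico 0 1 ∩ ⋂ i, (fun u => ⌈x i - (m i : ℕ) - u⌉) ⁻¹' {0} := by ext; simp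
    rw [this]
    refine measurableSet_Ico.inter (MeasurableSet.iInter fun i => ?_)
    exact (Int.measurable_ceil.comp (measurable_const.sub measurable_id)) (measurableSet_singleton 0)

/-! ### Approximate squaring and multiplication -/

/-- Iterates of the tent map `v ↦ 1 - 2|v|` of `[-1,1]`. -/
noncomputable def tent : ℕ → ℝ → ℝ
  | 0, v => v
  | k + 1, v => 1 - 2 * |tent k v|

/-- The sawtooth approximation of `v²` on `[-1,1]`. -/
noncomputable def sqApprox (n : ℕ) (v : ℝ) : ℝ :=
  ∑ k ∈ Finset.range n, (1 / 4 : ℝ) ^ k * (|tent k v| - 1 / 4) + (1 / 4) ^ n * |tent n v|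

theorem tent_succ' (k : ℕ) (v : ℝ) : tent (k + 1) v = tent k (1 - 2 * |v|) := by
  induction k with
  | zero => rfl
  | succ k ih => rw [tent, ih, tent]

/-- This mirrors the exact identity $v^2=|v|-\frac14+\frac14(1-2|v|)^2$; the approximation iterates
it and finally replaces $w^2$ by $|w|$. -/
theorem sqApprox_succ (n : ℕ) (v : ℝ) :
    sqApprox (n + 1) v = |v| - 1 / 4 + sqApprox n (1 - 2 * |v|) / 4 := by
  have h0 : tent 0 v = v := rfl
  simp only [sqApprox, Finset.sum_range_succ', tent_succ', h0, pow_succ, pow_zero, add_div,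
    Finset.sum_div, mul_one_div]
  ring_nf

/-- Each recursion step divides the initial error $0\le|w|-w^2\le\frac14$ by four. The bound by
$|v|$ keeps approximate products in $[-1,1]$, so that they can be nested. -/
theorem sqApprox_mem (n : ℕ) {v : ℝ} (hv : |v| ≤ 1) :
    v ^ 2 ≤ sqApprox n v ∧ sqApprox n v ≤ v ^ 2 + (1 / 4) ^ (n + 1) ∧ sqApprox n v ≤ |v| := by
  induction n generalizing v with
  | zero =>
    simp only [sqApprox, tent, Finset.range_zero, Finset.sum_empty, pow_zero, one_mul, zero_add,
      pow_one, le_refl, and_true]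
    constructor <;> nlinarith [sq_abs v, abs_nonneg v, sq_nonneg (|v| - 1 / 2)]
  | succ n ih =>
    have h0 := abs_nonneg v
    have h1 : |(1 - 2 * |v|)| ≤ 1 := abs_le.2 ⟨by linarith, by linarith⟩
    obtain ⟨h2, h3, h4⟩ := ih h1
    rw [sqApprox_succ, pow_succ _ (n + 1)]
    refine ⟨?_, ?_, ?_⟩ <;> nlinarith [sq_abs v]

theorem normNet_tent (k : ℕ) :
    NormNet 2 (2 * 4 ^ k - 1) k (fun (x : Unit → ℝ) (_ : Unit) => tent k (x ())) := by
  induction k with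
  | zero => exact NormNet.of_affine 2 1 0 (fun i => by norm_num) fun x i => by simp [tent]
  | succ k ih =>
    have h1 : (1 : ℝ) ≤ 4 ^ k := one_le_pow₀ (by norm_num)
    have := (ih.abs le_rfl (by linarith)).smul (R' := 2 * 4 ^ (k + 1) - 1) (-2) 1 (by
      rw [pow_succ]; norm_num; linarith)
    convert this using 3
    rw [tent]; ring

/-- The weight $4^{-k}$ cancels the growth $4^k$ of the norm of the $k$-th tent iterate. Recomputing
each iterate separately, in parallel, keeps every term at norm at most $4$, so the total is linear
in $n$. -/
theorem normNet_sqApprox (n : ℕ) :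
    NormNet (2 * (n + 1)) (5 * (n + 1)) (n + 1)
      (fun (x : Unit → ℝ) (_ : Unit) => sqApprox n (x ())) := by
  have h : ∀ k : Fin (n + 1), NormNet 2 4 (n + 1)
      (fun (x : Unit → ℝ) (_ : Unit) => (1 / 4) ^ (k : ℕ) * |tent k (x ())| + 0) := by
    intro k
    have h1 : (1 : ℝ) ≤ 4 ^ (k : ℕ) := one_le_pow₀ (by norm_num)
    refine (((normNet_tent k).abs le_rfl (by linarith)).smul (R' := 4) _ 0 ?_).depth_mono
      (by omega) (by omega)
    rw [abs_of_nonneg (by positivity), abs_zero, div_pow, one_pow, add_zero, one_div,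
      inv_mul_le_iff₀ (by positivity)]
    linarith
  have := NormNet.sum (R' := 5 * (n + 1)) h 1
    (∑ k ∈ Finset.range n, (1 / 4 : ℝ) ^ k * (- 1 / 4)) (by
      have h2 : |∑ k ∈ Finset.range n, (1 / 4 : ℝ) ^ k * (- 1 / 4)| ≤ n := by
        refine (Finset.abs_sum_le_sum_abs _ _).trans ?_
        refine (Finset.sum_le_card_nsmul _ _ 1 fun k _ => ?_).trans (by simp)
        rw [abs_mul, abs_of_nonneg (by positivity)]
        have : (1 / 4 : ℝ) ^ k ≤ 1 := pow_le_one₀ (by norm_num) (by norm_num)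
        norm_num
        norm_num at this
        linarith
      simp only [Pi.one_apply, abs_one, Finset.sum_const, Finset.card_univ, Fintype.card_fin,
        nsmul_eq_mul, mul_one, Nat.cast_add, Nat.cast_one]
      linarith)
  simp only [Finset.sum_const, Finset.card_univ, Fintype.card_fin, smul_eq_mul] at this
  rw [mul_comm]
  convert this using 3 with x
  rw [sqApprox, Fin.sum_univ_castSucc, Finset.sum_range, Finset.sum_range, add_right_comm,
    ← Finset.sum_add_distrib]
  simp only [Fin.val_castSucc, Fin.val_last, Pi.one_apply, one_mul, add_zero]
  congr 1
  exact Finset.sum_congr rfl fun k _ => by ring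

/-- Approximate multiplication on `[-1,1]²`. -/
noncomputable def mulApprox (n : ℕ) (a b : ℝ) : ℝ :=
  sqApprox n ((a + b) / 2) - sqApprox n ((a - b) / 2)

theorem abs_half_add_le {a b : ℝ} (ha : |a| ≤ 1) (hb : |b| ≤ 1) :
    |(a + b) / 2| ≤ 1 ∧ |(a - b) / 2| ≤ 1 := by
  rw [abs_le] at ha hb
  refine ⟨abs_le.2 ⟨?_, ?_⟩, abs_le.2 ⟨?_, ?_⟩⟩ <;> linarith

theorem abs_mulApprox_le {a b : ℝ} (n : ℕ) (ha : |a| ≤ 1) (hb : |b| ≤ 1) : |mulApprox n a b| ≤ 1 := by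
  obtain ⟨h, h'⟩ := abs_half_add_le ha hb
  obtain ⟨h1, h2, h3⟩ := sqApprox_mem n h
  obtain ⟨h1', h2', h3'⟩ := sqApprox_mem n h'
  unfold mulApprox
  rw [abs_le]
  constructor <;> nlinarith

theorem abs_mulApprox_sub_le {a b : ℝ} (n : ℕ) (ha : |a| ≤ 1) (hb : |b| ≤ 1) :
    |mulApprox n a b - a * b| ≤ (1 / 4) ^ n := by
  obtain ⟨h, h'⟩ := abs_half_add_le ha hb
  obtain ⟨h1, h2, h3⟩ := sqApprox_mem n h
  obtain ⟨h1', h2', h3'⟩ := sqApprox_mem n h'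
  have : (0 : ℝ) ≤ (1 / 4) ^ n := by positivity
  rw [pow_succ _ n] at h2 h2'
  unfold mulApprox
  rw [abs_le]
  constructor <;> nlinarith

theorem normNet_mulApprox (n : ℕ) :
    NormNet (4 * (n + 1)) (10 * (n + 1)) (n + 1)
      (fun (x : Bool → ℝ) (_ : Unit) => mulApprox n (x true) (x false)) := by
  have haff : ∀ ε : Bool, NormNet (2 * (n + 1)) 1 0 (fun (x : Bool → ℝ) (_ : Unit) =>
      cond ε ((x true + x false) / 2) ((x true - x false) / 2)) := fun ε =>
    NormNet.of_affine _ (fun _ i => cond (ε || i) (1 / 2) (-1 / 2)) 0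
      (fun i => by cases ε <;> norm_num) fun x i => by
        cases ε <;> simp <;> ring
  have := NormNet.sum (R' := 10 * (n + 1))
    (fun ε => (haff ε).comp (normNet_sqApprox n) le_rfl) (fun ε => cond ε 1 (-1)) 0
      (by norm_num; linarith)
  simp only [Finset.sum_const, Finset.card_univ, Fintype.card_bool, smul_eq_mul, ← mul_assoc] at this
  norm_num at this
  exact this

theorem NormNet.mulApprox {κ : Type} [Fintype κ] {f g : (κ → ℝ) → ℝ} {w w' L n : ℕ} {R : ℝ}
    (hR : 1 ≤ R) (hf : NormNet w R L (fun x (_ : Unit) => f x))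
    (hg : NormNet w' R L (fun x (_ : Unit) => g x)) :
    NormNet (max (w + w') (4 * (n + 1))) (R * (10 * (n + 1))) (n + 1 + L)
      (fun x (_ : Unit) => mulApprox n (f x) (g x)) := by
  have hp := NormNet.parallel_scalar (J := Bool) (w := fun b => cond b w w')
    (f := fun b => cond b f g) (R := R) (L := L) (fun b => by cases b <;> assumption)
  rw [Fintype.sum_bool] at hp
  exact (hp.mono (le_max_left _ _) le_rfl).comp
    ((normNet_mulApprox n).mono (le_max_right _ _) le_rfl) hR

/-- Truncation to `[-1,1]`. -/
noncomputable def clip (y : ℝ) : ℝ := max (y + 1) 0 - max (y - 1) 0 - 1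

theorem abs_clip_le (y : ℝ) : |clip y| ≤ 1 := by
  unfold clip
  rcases max_cases (y + 1) 0 with h | h <;> rcases max_cases (y - 1) 0 with h' | h' <;>
    rw [abs_le] <;> constructor <;> linarith

theorem clip_of_abs_le {y : ℝ} (hy : |y| ≤ 1) : clip y = y := by
  rw [abs_le] at hy
  unfold clip
  rw [max_eq_left (by linarith), max_eq_right (by linarith)]
  ring

theorem normNet_clip {κ : Type} [Fintype κ] (i : κ) :
    NormNet 2 5 1 (fun (x : κ → ℝ) (_ : Unit) => clip (x i)) := by
  classical
  have haff : ∀ ε : Bool, NormNet 1 2 0 (fun (x : κ → ℝ) (_ : Unit) =>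
      x i + cond ε 1 (-1)) := fun ε =>
    NormNet.of_affine _ (fun _ j => if j = i then 1 else 0) (fun _ => cond ε 1 (-1))
      (fun _ => by cases ε <;> simp [apply_ite abs] <;> norm_num) fun x _ => by simp
  have := NormNet.sum (R' := 5) (fun ε => (haff ε).relu le_rfl one_le_two)
    (fun ε => cond ε 1 (-1)) (-1) (by norm_num)
  simpa [clip, sub_eq_add_neg] using this

/-! ### Taylor expansion on the cube -/

theorem convex_unitCube (s : ℕ) : Convex ℝ (unitCube s) := by
  intro x hx y hy a b ha hb hab i
  have h1 := hx i
  have h2 := hy i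
  simp only [mem_Icc, PiLp.add_apply, PiLp.smul_apply, smul_eq_mul] at *
  constructor <;> nlinarith

theorem uniqueDiffOn_unitCube (s : ℕ) : UniqueDiffOn ℝ (unitCube s) := by
  refine uniqueDiffOn_convex (convex_unitCube s) ⟨WithLp.toLp 2 fun _ => 1 / 2, ?_⟩
  have h1 : IsOpen {y : EuclideanSpace ℝ (Fin s) | ∀ i, y i ∈ Ioo (0 : ℝ) 1} := by
    have : {y : EuclideanSpace ℝ (Fin s) | ∀ i, y i ∈ Ioo (0 : ℝ) 1} =
        ⋂ i, (fun y : EuclideanSpace ℝ (Fin s) => y i) ⁻¹' Ioo 0 1 := by ext; simp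
    rw [this]
    exact isOpen_iInter_of_finite fun i => isOpen_Ioo.preimage (by fun_prop)
  refine mem_interior.2 ⟨_, fun y (hy : ∀ i, y i ∈ Ioo (0 : ℝ) 1) i => Ioo_subset_Icc_self (hy i), h1, fun i => ?_⟩
  norm_num

section Taylor

variable {s r : ℕ} {g : EuclideanSpace ℝ (Fin s) → ℝ} {y z : EuclideanSpace ℝ (Fin s)}

theorem iteratedFDerivWithin_unitCube_diag (k : ℕ) (p h : EuclideanSpace ℝ (Fin s)) :
    iteratedFDerivWithin ℝ k g (unitCube s) p (fun _ => h) =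
      ∑ t : Fin k → Fin s, cubePartial t g p * ∏ i, h (t i) := by
  have hh : h = ∑ i, h i • EuclideanSpace.single i (1 : ℝ) := by
    ext j
    simp [Finset.sum_apply, Pi.single_apply]
  conv_lhs => rw [hh]
  rw [ContinuousMultilinearMap.map_sum]
  refine Finset.sum_congr rfl fun t _ => ?_
  rw [ContinuousMultilinearMap.map_smul_univ, smul_eq_mul, mul_comm]
  rfl

theorem segment_mem_unitCube (hy : y ∈ unitCube s) (hz : z ∈ unitCube s) {t : ℝ}
    (ht : t ∈ Icc (0 : ℝ) 1) : z + t • (y - z) ∈ unitCube s :=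
  (convex_unitCube s).add_smul_sub_mem hz hy ht

theorem iteratedDerivWithin_segment (hg : ContDiffOn ℝ r g (unitCube s)) (hy : y ∈ unitCube s)
    (hz : z ∈ unitCube s) {k : ℕ} (hk : k ≤ r) {t : ℝ} (ht : t ∈ Icc (0 : ℝ) 1) :
    iteratedDerivWithin k (fun t : ℝ => g (z + t • (y - z))) (Icc 0 1) t =
      iteratedFDerivWithin ℝ k g (unitCube s) (z + t • (y - z)) (fun _ => y - z) := by
  induction k generalizing t with
  | zero => simp
  | succ k ih =>
    rw [iteratedDerivWithin_succ, derivWithin_congr (fun u hu => ih (by omega) hu) (ih (by omega) ht),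
      iteratedFDerivWithin_succ_apply_left]
    have h1 : HasFDerivWithinAt (iteratedFDerivWithin ℝ k g (unitCube s)) _ (unitCube s)
        (z + t • (y - z)) :=
      (hg.differentiableOn_iteratedFDerivWithin (m := k) (by exact_mod_cast hk)
        (uniqueDiffOn_unitCube s) _ (segment_mem_unitCube hy hz ht)).hasFDerivWithinAt
    have h2 : HasDerivWithinAt (fun t : ℝ => z + t • (y - z)) (y - z) (Icc 0 1) t := by
      simpa using (((hasDerivAt_id t).smul_const (y - z)).const_add z).hasDerivWithinAt
    have h3 := h1.comp_hasDerivWithinAt t h2 fun u hu => segment_mem_unitCube hy hz hu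
    have h4 := (ContinuousMultilinearMap.apply ℝ (fun _ : Fin k => EuclideanSpace ℝ (Fin s)) ℝ
      (fun _ => y - z)).hasFDerivAt.comp_hasDerivWithinAt t h3
    exact h4.derivWithin (uniqueDiffOn_Icc zero_lt_one t ht)

/-- Lagrange's remainder on the segment from `z` to `y`, which stays in the cube by convexity.
Keeping the order `r` term at an intermediate point leaves only a difference of derivatives to be
estimated by the Hölder condition. -/
theorem exists_taylor_segment (hg : ContDiffOn ℝ r g (unitCube s)) (hy : y ∈ unitCube s)
    (hz : z ∈ unitCube s) : ∃ p ∈ unitCube s, ‖p - z‖ ≤ ‖y - z‖ ∧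
      g y - ∑ k ∈ Finset.range r, (k.factorial : ℝ)⁻¹ *
        iteratedFDerivWithin ℝ k g (unitCube s) z (fun _ => y - z) =
      (r.factorial : ℝ)⁻¹ * iteratedFDerivWithin ℝ r g (unitCube s) p (fun _ => y - z) := by
  cases r with
  | zero => exact ⟨y, hy, le_rfl, by simp⟩
  | succ r =>
    have hφ : ContDiffOn ℝ (r + 1 : ℕ) (fun t : ℝ => g (z + t • (y - z))) (Icc 0 1) :=
      hg.comp (by fun_prop) fun t ht => segment_mem_unitCube hy hz ht
    have h01 : uIcc (0 : ℝ) 1 = Icc 0 1 := uIcc_of_le zero_le_one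
    obtain ⟨ξ, hξ, h⟩ := taylor_mean_remainder_lagrange (n := r) (zero_ne_one (α := ℝ))
      (f := fun t : ℝ => g (z + t • (y - z))) (by
        rw [h01]; exact hφ.of_le (by exact_mod_cast r.le_succ)) (by
        rw [h01, uIoo_of_le zero_le_one]
        exact (hφ.differentiableOn_iteratedDerivWithin (by exact_mod_cast r.lt_succ_self)
          (uniqueDiffOn_Icc zero_lt_one)).mono Ioo_subset_Icc_self)
    rw [uIoo_of_le zero_le_one] at hξ
    have hξ' := Ioo_subset_Icc_self hξ
    refine ⟨_, segment_mem_unitCube hy hz hξ', ?_, ?_⟩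
    · rw [add_sub_cancel_left, norm_smul, Real.norm_of_nonneg hξ.1.le]
      exact mul_le_of_le_one_left (norm_nonneg _) hξ.2.le
    · rw [h01, taylor_within_apply, iteratedDerivWithin_segment hg hy hz le_rfl hξ'] at h
      simp only [sub_zero, one_pow, mul_one, one_smul, add_sub_cancel, smul_eq_mul] at h
      rw [div_eq_inv_mul] at h
      rw [← h]
      congr 1
      refine Finset.sum_congr rfl fun k hk => ?_
      rw [iteratedDerivWithin_segment hg hy hz (Finset.mem_range.1 hk).le ⟨le_rfl, zero_le_one⟩,
        zero_smul, add_zero]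

/-- Taylor's formula on the cube with Hölder remainder. -/
theorem abs_sub_taylor_le {ν B : ℝ} (hν : 0 < ν) (hB : 0 ≤ B)
    (hg : ContDiffOn ℝ r g (unitCube s))
    (hH : ∀ t : Fin r → Fin s, ∀ y ∈ unitCube s, ∀ z ∈ unitCube s,
      |cubePartial t g y - cubePartial t g z| ≤ B * ‖y - z‖ ^ ν)
    (hy : y ∈ unitCube s) (hz : z ∈ unitCube s) :
    |g y - ∑ k ∈ Finset.range (r + 1), (k.factorial : ℝ)⁻¹ *
        ∑ t : Fin k → Fin s, cubePartial t g z * ∏ i, (y - z) (t i)| ≤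
      s ^ r * (B * ‖y - z‖ ^ (r + ν)) := by
  obtain ⟨p, hp, hpz, h⟩ := exists_taylor_segment hg hy hz
  simp only [iteratedFDerivWithin_unitCube_diag] at h
  -- The error is the order `r` term at `p` minus that at `z`. The $s^r$ tuples each contribute at
  -- most $B\|y-z\|^\nu\cdot\|y-z\|^r$.
  rw [Finset.sum_range_succ, ← sub_sub, h, ← mul_sub, ← Finset.sum_sub_distrib, abs_mul,
    abs_of_nonneg (by positivity)]
  have hf : ((r.factorial : ℝ))⁻¹ ≤ 1 :=
    inv_le_one_of_one_le₀ (by exact_mod_cast r.factorial_pos)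
  refine (mul_le_of_le_one_left (abs_nonneg _) hf).trans ?_
  refine (Finset.abs_sum_le_sum_abs _ _).trans ?_
  refine (Finset.sum_le_card_nsmul _ _ (B * ‖y - z‖ ^ (r + ν)) fun t _ => ?_).trans (by simp)
  rw [← sub_mul, abs_mul, Finset.abs_prod, Real.rpow_add_of_nonneg (norm_nonneg _) (by positivity)
    hν.le, Real.rpow_natCast, mul_comm (‖y - z‖ ^ r), ← mul_assoc]
  refine mul_le_mul ((hH t p hp z hz).trans ?_) ?_ (Finset.prod_nonneg fun _ _ => abs_nonneg _)
    (by positivity)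
  · exact mul_le_mul_of_nonneg_left (Real.rpow_le_rpow (norm_nonneg _) hpz hν.le) hB
  · refine (Finset.prod_le_prod (fun _ _ => abs_nonneg _) fun i _ =>
      PiLp.norm_apply_le (y - z) (t i)).trans ?_
    simp

end Taylor

theorem EuclideanSpace.norm_le_sum_abs {ι : Type*} [Fintype ι] (x : EuclideanSpace ℝ ι) :
    ‖x‖ ≤ ∑ i, |x i| := by
  classical
  have hx : x = ∑ i, x i • EuclideanSpace.single i (1 : ℝ) := by
    ext j
    simp [Finset.sum_apply, Pi.single_apply]
  calc ‖x‖ = ‖∑ i, x i • EuclideanSpace.single i (1 : ℝ)‖ := by rw [← hx]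
    _ ≤ ∑ i, ‖x i • EuclideanSpace.single i (1 : ℝ)‖ := norm_sum_le _ _
    _ = ∑ i, |x i| := by simp [norm_smul]

/-! ### Localized monomials and their networks -/

/-- The nodal function at the origin, lowered by the last variable. -/
noncomputable def nodeWeight {s : ℕ} (z : Option (Fin s) → ℝ) : ℝ :=
  max (nodal (fun i => z (some i)) - z none) 0

/-- The network approximation of `nodeWeight z * ∏ i ∈ l, z i`. -/
noncomputable def feature {s : ℕ} (n : ℕ) : List (Fin s) → (Option (Fin s) → ℝ) → ℝ
  | [], z => nodeWeight z
  | i :: l, z => mulApprox n (feature n l z) (clip (z (some i)))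

section Feature

variable {s : ℕ} {z : Option (Fin s) → ℝ}

theorem nodal_le_one (y : Fin s → ℝ) : nodal y ≤ 1 := by
  have h1 := (foldr_max_le_iff (List.finRange s) (fun i => 1 * y i) _).1 le_rfl
  have h2 := (foldr_max_le_iff (List.finRange s) (fun i => -1 * y i) _).1 le_rfl
  exact max_le (by linarith [h1.1, h2.1]) zero_le_one

theorem nodeWeight_nonneg : 0 ≤ nodeWeight z := le_max_right _ _

theorem nodeWeight_le_nodal (hz : 0 ≤ z none) : nodeWeight z ≤ nodal (fun i => z (some i)) :=
  max_le (by linarith) (nodal_nonneg _)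

theorem nodeWeight_of_eq_zero (hz : z none = 0) : nodeWeight z = nodal (fun i => z (some i)) := by
  rw [nodeWeight, hz, sub_zero, max_eq_left (nodal_nonneg _)]

theorem nodeWeight_of_one_le (hz : 1 ≤ z none) : nodeWeight z = 0 :=
  max_eq_right (by linarith [nodal_le_one fun i => z (some i)])

theorem abs_lt_one_of_nodeWeight_ne_zero (hz : 0 ≤ z none) (h : nodeWeight z ≠ 0) (i : Fin s) :
    |z (some i)| < 1 :=
  abs_lt_one_of_nodal_ne_zero (y := fun i => z (some i))
    (fun h0 => h (le_antisymm (h0 ▸ nodeWeight_le_nodal hz) nodeWeight_nonneg)) i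

theorem abs_feature_le (n : ℕ) (l : List (Fin s)) (hz : 0 ≤ z none) : |feature n l z| ≤ 1 := by
  induction l with
  | nil =>
    rw [feature, abs_of_nonneg nodeWeight_nonneg]
    exact (nodeWeight_le_nodal hz).trans (nodal_le_one _)
  | cons i l ih => exact abs_mulApprox_le n ih (abs_clip_le _)

/-- Errors add up over the factors, since each clipped factor is at most `1` in modulus. -/
theorem abs_feature_sub_le (n : ℕ) (l : List (Fin s)) (hz : 0 ≤ z none) :
    |feature n l z - nodeWeight z * (l.map fun i => z (some i)).prod| ≤
      l.length * (1 / 4) ^ n := by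
  induction l with
  | nil => simp [feature]
  | cons i l ih =>
    have h1 := abs_mulApprox_sub_le n (abs_feature_le n l hz) (abs_clip_le (z (some i)))
    set F := feature n l z
    set P := (l.map fun i => z (some i)).prod with hP
    -- Clipping is invisible: where the weight is nonzero, all coordinates lie in $(-1,1)$.
    have h2 : nodeWeight z * ((i :: l).map fun i => z (some i)).prod =
        nodeWeight z * P * clip (z (some i)) := by
      by_cases h : nodeWeight z = 0
      · simp [h]
      · rw [clip_of_abs_le (abs_lt_one_of_nodeWeight_ne_zero hz h i).le, List.map_cons,
          List.prod_cons, ← hP]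
        ring
    rw [h2, feature]
    have h3 : |F * clip (z (some i)) - nodeWeight z * P * clip (z (some i))| ≤
        l.length * (1 / 4) ^ n := by
      rw [← sub_mul, abs_mul]
      exact (mul_le_of_le_one_right (abs_nonneg _) (abs_clip_le _)).trans ih
    refine (abs_sub_le _ (F * clip (z (some i))) _).trans ?_
    rw [List.length_cons]
    push_cast
    linarith

theorem isNetFun_nodeWeight (s : ℕ) : IsNetFun (nodeWeight (s := s)) :=
  (((isNetFun_nodal s).select some).sub (IsNetFun.coord none)).relu

/-- Each of the `k` multiplications costs a factor $10(n+1)\le20n$ in norm and $n+1$ layers. -/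
theorem exists_normNet_feature (s k : ℕ) : ∃ c : ℕ, 1 ≤ c ∧ ∀ n : ℕ, 1 ≤ n →
    ∀ l : List (Fin s), l.length = k → NormNet (c * n) (c * n ^ k) (c * n)
      (fun (z : Option (Fin s) → ℝ) (_ : Unit) => feature n l z) := by
  induction k with
  | zero =>
    obtain ⟨w, R, L, hR, hL, h⟩ := (isNetFun_nodeWeight s).exists_pos_depth
    refine ⟨max (max w L) ⌈R⌉₊, (hL.trans_le (by simp)), fun n hn l hl => ?_⟩
    obtain rfl := List.length_eq_zero_iff.1 hl
    refine (h.mono ?_ ?_).depth_mono hL ?_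
    · exact (le_max_left w L).trans ((le_max_left _ _).trans (Nat.le_mul_of_pos_right _ hn))
    · rw [pow_zero, mul_one]
      exact (Nat.le_ceil R).trans (by exact_mod_cast le_max_right _ _)
    · exact (le_max_right w L).trans ((le_max_left _ _).trans (Nat.le_mul_of_pos_right _ hn))
  | succ k ih =>
    obtain ⟨c, hc, ih⟩ := ih
    -- The summand `5` accommodates the norm of `clip`.
    refine ⟨20 * (c + 5), by omega, fun n hn l hl => ?_⟩
    obtain ⟨i, l, rfl⟩ := List.exists_cons_of_length_eq_add_one hl
    have hn' : (1 : ℝ) ≤ n := by exact_mod_cast hn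
    have hnk : (1 : ℝ) ≤ n ^ k := one_le_pow₀ hn'
    have hcn : c ≤ c * n := Nat.le_mul_of_pos_right _ hn
    have h1 := (ih n hn l (by simpa using hl)).mono (le_refl (c * n))
      (show (c : ℝ) * n ^ k ≤ (c + 5) * n ^ k by nlinarith)
    have h2 := ((normNet_clip (some i)).mono le_rfl
      (show (5 : ℝ) ≤ (c + 5) * n ^ k by nlinarith)).depth_mono one_pos (show 1 ≤ c * n by omega)
    have h3 := NormNet.mulApprox (n := n) (by nlinarith) h1 h2
    refine (h3.mono ?_ ?_).depth_mono (by omega) ?_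
    · refine max_le ?_ ?_ <;> nlinarith
    · push_cast
      rw [pow_succ, mul_assoc (20 : ℝ), mul_left_comm 20, mul_assoc (c + 5 : ℝ)]
      refine mul_le_mul_of_nonneg_left ?_ (by positivity)
      nlinarith
    · nlinarith

/-- Indices of the monomials of degree at most `r`. -/
abbrev MonoIndex (s r : ℕ) : Type := Σ k : Fin (r + 1), (Fin k → Fin s)

/-- Blow-up by the factor `N` at the grid point `m / N`. -/
def zoom {s : ℕ} (N : ℕ) (m : Fin s → Fin (N + 1)) (z : Option (Fin s) → ℝ) :
    Option (Fin s) → ℝ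
  | none => z none
  | some i => N * z (some i) - (m i : ℕ)

/-- The network approximation of a localized piecewise polynomial. -/
noncomputable def gridApprox {s r : ℕ} (N n : ℕ) (a : (Fin s → Fin (N + 1)) → MonoIndex s r → ℝ)
    (z : Option (Fin s) → ℝ) : ℝ :=
  ∑ m, ∑ t : MonoIndex s r,
    a m t * ((1 / N) ^ (t.1 : ℕ) * feature n (List.ofFn t.2) (zoom N m z))

theorem normNet_zoom {N : ℕ} (hN : 1 ≤ N) (m : Fin s → Fin (N + 1)) (w : ℕ) :
    NormNet w (2 * N) 0 (zoom N m) := by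
  have hN' : (1 : ℝ) ≤ N := by exact_mod_cast hN
  refine NormNet.of_affine w (fun i j => if j = i then i.elim 1 (fun _ => (N : ℝ)) else 0)
    (fun i => i.elim 0 (fun i => - (m i : ℕ))) ?_ ?_
  · rintro (_ | i)
    · simp [apply_ite abs]; linarith
    · have : ((m i : ℕ) : ℝ) ≤ N := by exact_mod_cast Nat.lt_succ_iff.1 (m i).2
      simp [apply_ite abs]; linarith
  · rintro x (_ | i)
    · simp [zoom]
    · simp [zoom, sub_eq_add_neg]

/-- All features run in parallel and the `K` output rows only differ in their coefficients. The norm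
consists of $N$ from the zoom and $(N+1)^sB$ from the coefficients. -/
theorem exists_normNet_gridApprox (s r : ℕ) : ∃ c : ℕ, 1 ≤ c ∧ ∀ N n : ℕ, 1 ≤ n → n ≤ N →
    ∀ (K : ℕ) (B : ℝ), 0 ≤ B → ∀ (a : Fin K → (Fin s → Fin (N + 1)) → MonoIndex s r → ℝ),
    (∀ i m t, |a i m t| ≤ B) →
    NormNet (c * n * (N + 1) ^ s) (c * N * (N + 1) ^ s * B) (c * n)
      (fun z i => gridApprox N n (a i) z) := by
  choose c hc h using exists_normNet_feature s
  set C := ∑ k ∈ Finset.range (r + 1), c k with hC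
  have hcC : ∀ k : Fin (r + 1), c k ≤ C := fun k =>
    Finset.single_le_sum (f := c) (fun _ _ => Nat.zero_le _) (Finset.mem_range.2 k.2)
  set T := Fintype.card (MonoIndex s r) with hT
  have hC1 : 1 ≤ C := (hc 0).trans (hcC 0)
  refine ⟨2 * C * (T + 1), by nlinarith [Nat.zero_le T], fun N n hn hnN K B hB a ha => ?_⟩
  have hN' : (1 : ℝ) ≤ N := by exact_mod_cast hn.trans hnN
  have key : ∀ q : (Fin s → Fin (N + 1)) × MonoIndex s r,
      NormNet (C * n) (2 * C * N) (C * n) (fun (z : Option (Fin s) → ℝ) (_ : Unit) =>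
        (1 / N : ℝ) ^ (q.2.1 : ℕ) * feature n (List.ofFn q.2.2) (zoom N q.1 z) + 0) := by
    rintro ⟨m, ⟨k, t⟩⟩
    have hck : (c k : ℝ) ≤ C := by exact_mod_cast hcC k
    have h1 := (h k n hn (List.ofFn t) (by simp)).mono (Nat.mul_le_mul_right n (hcC k)) le_rfl
    have h2 := ((normNet_zoom (hn.trans hnN) m (C * n)).comp h1 (by linarith)).smul
      (R' := 2 * C * N) ((1 / N) ^ (k : ℕ)) 0 (by
        -- Here `n ≤ N` pays for the norm of the multiplications.
        have h4 : ((1 : ℝ) / N) ^ (k : ℕ) * n ^ (k : ℕ) ≤ 1 := by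
          rw [← mul_pow, one_div_mul_eq_div]
          exact pow_le_one₀ (by positivity) (div_le_one_of_le₀ (by exact_mod_cast hnN)
            (by positivity))
        rw [abs_zero, add_zero, abs_of_nonneg (by positivity)]
        calc ((1 : ℝ) / N) ^ (k : ℕ) * (2 * N * (c k * n ^ (k : ℕ)))
            = (((1 : ℝ) / N) ^ (k : ℕ) * n ^ (k : ℕ)) * (2 * N * c k) := by ring
          _ ≤ 1 * (2 * N * c k) := mul_le_mul_of_nonneg_right h4 (by positivity)
          _ ≤ 2 * C * N := by nlinarith)
    exact h2.depth_mono (by have := Nat.mul_pos (hc k) hn; omega)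
      (by rw [add_zero]; exact Nat.mul_le_mul_right n (hcC k))
  have hall := (NormNet.parallel_scalar key).post_affine (R' := 2 * C * N * ((N + 1) ^ s * T * B))
    (fun (i : Fin K) q => a i q.1 q.2) 0 fun i => by
      have : ∑ q : (Fin s → Fin (N + 1)) × MonoIndex s r, |a i q.1 q.2| ≤ (N + 1) ^ s * T * B := by
        refine (Finset.sum_le_card_nsmul _ _ B fun q _ => ha i q.1 q.2).trans (le_of_eq ?_)
        simp [← hT]
      simp only [Pi.zero_apply, abs_zero, add_zero]
      rw [mul_comm]
      exact mul_le_mul_of_nonneg_left this (by positivity)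
  have hall' := (hall.mono (w' := 2 * C * (T + 1) * n * (N + 1) ^ s)
    (R' := (2 * C * (T + 1) : ℕ) * N * (N + 1) ^ s * B) ?_ ?_).depth_mono (Nat.mul_pos hC1 hn)
    (L' := 2 * C * (T + 1) * n) ?_
  · convert hall' using 3
    simp [gridApprox, Fintype.sum_prod_type]
  · simp only [Finset.sum_const, Finset.card_univ, Fintype.card_prod, smul_eq_mul, ← hT,
      Fintype.card_pi_const, Fintype.card_fin]
    calc (N + 1) ^ s * T * (C * n) = C * T * (n * (N + 1) ^ s) := by ring
      _ ≤ 2 * C * (T + 1) * (n * (N + 1) ^ s) := Nat.mul_le_mul_right _ (by nlinarith)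
      _ = _ := by ring
  · push_cast
    calc 2 * (C : ℝ) * N * ((N + 1) ^ s * T * B) = 2 * C * T * (N * (N + 1) ^ s * B) := by ring
      _ ≤ 2 * C * (T + 1) * (N * (N + 1) ^ s * B) :=
        mul_le_mul_of_nonneg_right (by nlinarith [(C.cast_nonneg : (0 : ℝ) ≤ C)]) (by positivity)
      _ = _ := by ring
  · exact Nat.mul_le_mul_right n (by nlinarith)

/-- The network approximation is close to the localized piecewise polynomial. -/
theorem abs_gridApprox_sub_le {r N n : ℕ} {B : ℝ} (hN : 1 ≤ N) (hz : 0 ≤ z none)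
    {a : (Fin s → Fin (N + 1)) → MonoIndex s r → ℝ} (hB : 0 ≤ B) (ha : ∀ m t, |a m t| ≤ B) :
    |gridApprox N n a z - ∑ m, nodeWeight (zoom N m z) *
        ∑ t : MonoIndex s r, a m t * ∏ i, (z (some (t.2 i)) - (m (t.2 i) : ℕ) / N)| ≤
      (N + 1) ^ s * Fintype.card (MonoIndex s r) * (B * (r * (1 / 4) ^ n)) := by
  have hN' : (1 : ℝ) ≤ N := by exact_mod_cast hN
  have hN0 : (N : ℝ) ≠ 0 := by positivity
  simp only [gridApprox, Finset.mul_sum, ← Finset.sum_sub_distrib]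
  refine (Finset.abs_sum_le_sum_abs _ _).trans ?_
  refine (Finset.sum_le_card_nsmul _ _ (Fintype.card (MonoIndex s r) *
    (B * (r * (1 / 4) ^ n))) fun m _ => ?_).trans (le_of_eq ?_)
  · refine (Finset.abs_sum_le_sum_abs _ _).trans ?_
    refine (Finset.sum_le_card_nsmul _ _ (B * (r * (1 / 4) ^ n)) fun t _ => ?_).trans (le_of_eq ?_)
    · have h1 := abs_feature_sub_le n (List.ofFn t.2) (z := zoom N m z) hz
      rw [List.map_ofFn, List.prod_ofFn, List.length_ofFn] at h1
      have h2 : ∏ i, (z (some (t.2 i)) - (m (t.2 i) : ℕ) / N) = (1 / N : ℝ) ^ (t.1 : ℕ) *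
          ∏ i, ((fun i => zoom N m z (some i)) ∘ t.2) i := by
        rw [← Fin.prod_const, ← Finset.prod_mul_distrib]
        refine Finset.prod_congr rfl fun i _ => ?_
        simp only [zoom, Function.comp]
        field_simp
      rw [h2, show nodeWeight (zoom N m z) * (a m t * ((1 / N : ℝ) ^ (t.1 : ℕ) *
          ∏ i, ((fun i => zoom N m z (some i)) ∘ t.2) i)) = a m t * ((1 / N : ℝ) ^ (t.1 : ℕ) *
          (nodeWeight (zoom N m z) * ∏ i, ((fun i => zoom N m z (some i)) ∘ t.2) i)) by ring,
        ← mul_sub, ← mul_sub, abs_mul, abs_mul]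
      refine mul_le_mul (ha m t) ?_ (by positivity) hB
      have h3 : |(1 / N : ℝ) ^ (t.1 : ℕ)| ≤ 1 := by
        rw [abs_of_nonneg (by positivity)]
        exact pow_le_one₀ (by positivity) (by rw [div_le_one (by positivity)]; exact hN')
      refine (mul_le_of_le_one_left (abs_nonneg _) h3).trans (h1.trans ?_)
      refine mul_le_mul_of_nonneg_right ?_ (by positivity)
      exact_mod_cast Nat.lt_succ_iff.1 t.1.2
    · simp
  · simp
    ring

theorem sum_nodeWeight_zoom {N : ℕ} (h0 : ∀ i, z (some i) ∈ Icc (0 : ℝ) 1) (hz : z none = 0) :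
    ∑ m, nodeWeight (zoom N m z) = 1 := by
  rw [← sum_nodal_eq_one (N := N) (x := fun i => N * z (some i)) fun i =>
    ⟨mul_nonneg (Nat.cast_nonneg _) (h0 i).1, mul_le_of_le_one_right (Nat.cast_nonneg _) (h0 i).2⟩]
  exact Finset.sum_congr rfl fun m _ => nodeWeight_of_eq_zero hz

theorem sum_nodeWeight_zoom_le {N : ℕ} (h0 : ∀ i, z (some i) ∈ Icc (0 : ℝ) 1) (hz : 0 ≤ z none) :
    ∑ m, nodeWeight (zoom N m z) ≤ 1 := by
  rw [← sum_nodal_eq_one (N := N) (x := fun i => N * z (some i)) fun i =>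
    ⟨mul_nonneg (Nat.cast_nonneg _) (h0 i).1, mul_le_of_le_one_right (Nat.cast_nonneg _) (h0 i).2⟩]
  exact Finset.sum_le_sum fun m _ => nodeWeight_le_nodal (z := zoom N m z) hz

end Feature

/-! ### Gluing Taylor polynomials -/

/-- The Taylor coefficients of `g` at the grid points. -/
noncomputable def taylorCoeff {s : ℕ} (r N : ℕ) (g : EuclideanSpace ℝ (Fin s) → ℝ)
    (m : Fin s → Fin (N + 1)) (t : MonoIndex s r) : ℝ :=
  ((t.1 : ℕ).factorial : ℝ)⁻¹ * cubePartial t.2 g (WithLp.toLp 2 fun i => (m i : ℕ) / N)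

theorem gridPoint_mem_unitCube {s N : ℕ} (m : Fin s → Fin (N + 1)) :
    (WithLp.toLp 2 fun i => (m i : ℕ) / N : EuclideanSpace ℝ (Fin s)) ∈ unitCube s := fun i =>
  ⟨by positivity, div_le_one_of_le₀ (by exact_mod_cast Nat.lt_succ_iff.1 (m i).2) (by positivity)⟩

theorem abs_taylorCoeff_le {s r N : ℕ} {g : EuclideanSpace ℝ (Fin s) → ℝ} {B : ℝ}
    (hg : ∀ k ≤ r, ∀ t : Fin k → Fin s, ∀ y ∈ unitCube s, |cubePartial t g y| ≤ B)
    (m : Fin s → Fin (N + 1)) (t : MonoIndex s r) : |taylorCoeff r N g m t| ≤ B := by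
  rw [taylorCoeff, abs_mul, abs_of_nonneg (by positivity)]
  refine (mul_le_of_le_one_left (abs_nonneg _) (inv_le_one_of_one_le₀ ?_)).trans
    (hg _ (Nat.lt_succ_iff.1 t.1.2) _ _ (gridPoint_mem_unitCube m))
  exact_mod_cast Nat.factorial_pos _

/-- The piecewise Taylor polynomial approximates `g` to order `r + ν`. -/
theorem abs_sum_nodeWeight_taylor_sub_le {s r N : ℕ} {ν B : ℝ} (hN : 1 ≤ N) (hν : 0 < ν)
    (hB : 0 ≤ B) {g : EuclideanSpace ℝ (Fin s) → ℝ} (hg : ContDiffOn ℝ r g (unitCube s))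
    (hH : ∀ t : Fin r → Fin s, ∀ y ∈ unitCube s, ∀ z ∈ unitCube s,
      |cubePartial t g y - cubePartial t g z| ≤ B * ‖y - z‖ ^ ν)
    {y : EuclideanSpace ℝ (Fin s)} (hy : y ∈ unitCube s) {η : ℝ} (hη : 0 ≤ η)
    (hgη : η = 0 ∨ g y = 0) :
    |∑ m, nodeWeight (zoom N m (fun i => i.elim η y)) * ∑ t : MonoIndex s r,
        taylorCoeff r N g m t * ∏ i, (y (t.2 i) - (m (t.2 i) : ℕ) / N) - g y| ≤
      s ^ r * B * (s / N) ^ (r + ν) := by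
  have hN' : (1 : ℝ) ≤ N := by exact_mod_cast hN
  -- The weights reproduce `g y` in both cases: they sum to one if `η = 0`, and their sum is
  -- irrelevant if `g y = 0`.
  have h1 : ∑ m, nodeWeight (zoom N m (fun i => i.elim η y)) * g y = g y := by
    rw [← Finset.sum_mul]
    rcases hgη with h | h
    · rw [sum_nodeWeight_zoom (fun i => hy i) h, one_mul]
    · rw [h, mul_zero]
  have h2 := sum_nodeWeight_zoom_le (N := N) (z := fun i => i.elim η y) (fun i => hy i) hη
  conv_lhs => rw [← h1]
  rw [← Finset.sum_sub_distrib]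
  refine (Finset.abs_sum_le_sum_abs _ _).trans ?_
  have h3 : ∀ m : Fin s → Fin (N + 1), |nodeWeight (zoom N m (fun i => i.elim η y)) *
      ∑ t : MonoIndex s r, taylorCoeff r N g m t * ∏ i, (y (t.2 i) - (m (t.2 i) : ℕ) / N) -
        nodeWeight (zoom N m (fun i => i.elim η y)) * g y| ≤
      nodeWeight (zoom N m (fun i => i.elim η y)) * (s ^ r * B * (s / N) ^ (r + ν)) := by
    intro m
    rw [← mul_sub, abs_mul, abs_of_nonneg nodeWeight_nonneg]
    by_cases h0 : nodeWeight (zoom N m (fun i => i.elim η y)) = 0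
    · simp [h0]
    refine mul_le_mul_of_nonneg_left ?_ nodeWeight_nonneg
    have h4 := abs_sub_taylor_le hν hB hg hH hy (gridPoint_mem_unitCube m)
    have h5 : ‖y - WithLp.toLp 2 fun i => ((m i : ℕ) : ℝ) / N‖ ≤ s / N := by
      refine (EuclideanSpace.norm_le_sum_abs _).trans
        ((Finset.sum_le_card_nsmul _ _ (1 / N : ℝ) fun i _ => ?_).trans (le_of_eq ?_))
      · have h7 := abs_lt_one_of_nodeWeight_ne_zero (z := zoom N m (fun i => i.elim η y)) hη h0 i
        have h8 : (y - WithLp.toLp 2 fun i => ((m i : ℕ) : ℝ) / N) i =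
            zoom N m (fun i => i.elim η y) (some i) * (1 / N) := by
          simp only [PiLp.sub_apply, zoom, Option.elim]
          field_simp
        rw [h8, abs_mul, abs_of_nonneg (by positivity : (0 : ℝ) ≤ 1 / N)]
        exact mul_le_of_le_one_left (by positivity) h7.le
      · simp [div_eq_mul_inv]
    have h6 : ∑ t : MonoIndex s r, taylorCoeff r N g m t * ∏ i, (y (t.2 i) - (m (t.2 i) : ℕ) / N) =
        ∑ k ∈ Finset.range (r + 1), (k.factorial : ℝ)⁻¹ * ∑ t : Fin k → Fin s,
          cubePartial t g (WithLp.toLp 2 fun i => ((m i : ℕ) : ℝ) / N) *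
            ∏ i, (y - WithLp.toLp 2 fun i => ((m i : ℕ) : ℝ) / N) (t i) := by
      rw [Fintype.sum_sigma, Finset.sum_range]
      simp [taylorCoeff, Finset.mul_sum, mul_assoc]
    rw [h6, abs_sub_comm]
    refine h4.trans ?_
    rw [← mul_assoc]
    gcongr
  refine (Finset.sum_le_sum fun m _ => h3 m).trans ?_
  rw [← Finset.sum_mul]
  exact mul_le_of_le_one_left (by positivity) h2

/-! ### Geometry of the manifold -/

/-- By compactness it is enough to argue locally, where the manifold lies in a Lipschitz image of a
ball of $\mathbb R^s$. -/
theorem hausdorffMeasure_lt_top_of_isEmbeddedManifold {d s : ℕ}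
    {A : Set (EuclideanSpace ℝ (Fin d))} (hA : IsCompact A) (hM : IsEmbeddedManifold d s A) :
    Measure.hausdorffMeasure (s : ℝ) A < ⊤ := by
  refine hA.measure_lt_top_of_nhdsWithin fun p hp => ?_
  obtain ⟨Φ, hpΦ, -, hsymm, hΦ⟩ := hM p hp
  have hΦp := Φ.map_source hpΦ
  obtain ⟨C, t, ht, hlip⟩ := ((hsymm.contDiffAt (Φ.open_target.mem_nhds hΦp)).of_le
    (by exact_mod_cast le_top : (1 : WithTop ℕ∞) ≤ ∞)).exists_lipschitzOnWith
  set V := t ∩ Metric.closedBall (Φ p) 1 with hV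
  have hVn : V ∈ 𝓝 (Φ p) := Filter.inter_mem ht (Metric.closedBall_mem_nhds _ one_pos)
  set Z : Set (EuclideanSpace ℝ (Fin s) × EuclideanSpace ℝ (Fin (d - s))) :=
    (fun u => (u, 0)) '' Metric.closedBall (Φ p).1 1 with hZ
  have hZfin : Measure.hausdorffMeasure (s : ℝ) Z < ⊤ := by
    have h1 : LipschitzWith 1 (fun u : EuclideanSpace ℝ (Fin s) =>
        (u, (0 : EuclideanSpace ℝ (Fin (d - s))))) := LipschitzWith.prodMk_right 0
    refine (h1.hausdorffMeasure_image_le (Nat.cast_nonneg s) _).trans_lt ?_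
    have h2 := (isCompact_closedBall (Φ p).1 1).measure_lt_top
      (μ := Measure.hausdorffMeasure (Module.finrank ℝ (EuclideanSpace ℝ (Fin s)) : ℝ))
    rw [finrank_euclideanSpace_fin] at h2
    simpa using h2
  refine ⟨Φ.symm '' (V ∩ Z), ?_, ?_⟩
  · filter_upwards [mem_nhdsWithin_of_mem_nhds (Φ.open_source.mem_nhds hpΦ),
      mem_nhdsWithin_of_mem_nhds (Φ.continuousAt hpΦ hVn), self_mem_nhdsWithin] with x hx hxV hxA
    refine ⟨Φ x, ⟨hxV, (Φ x).1, ?_, ?_⟩, Φ.left_inv hx⟩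
    · have : dist (Φ x) (Φ p) ≤ 1 := hxV.2
      exact (le_max_left _ _).trans this
    · exact Prod.ext rfl ((hΦ x hx).1 hxA).2.symm
  · refine ((hlip.mono (inter_subset_left.trans inter_subset_left)).hausdorffMeasure_image_le
      (Nat.cast_nonneg s)).trans_lt ?_
    exact ENNReal.mul_lt_top (ENNReal.rpow_lt_top_of_nonneg (Nat.cast_nonneg s) ENNReal.coe_ne_top)
      ((measure_mono inter_subset_right).trans_lt hZfin)

/-- A finite sum of $\ell^1$-cones centred on `S`. The $\ell^1$-norm is computed exactly by a
network and dominates the Euclidean norm, so each cone vanishes on `A` outside `U`. -/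
theorem exists_isNetFun_bump {d : ℕ} {A U S : Set (EuclideanSpace ℝ (Fin d))} (hS : IsCompact S)
    (hSU : S ⊆ relInterior A U) : ∃ β : (Fin d → ℝ) → ℝ, IsNetFun β ∧ (∀ x, 0 ≤ β x) ∧
      (∀ x ∈ S, 1 ≤ β x.ofLp) ∧ ∀ x ∈ A, x ∉ U → β x.ofLp = 0 := by
  refine hS.induction_on (p := fun S => ∃ β : (Fin d → ℝ) → ℝ, IsNetFun β ∧ (∀ x, 0 ≤ β x) ∧
    (∀ x ∈ S, 1 ≤ β x.ofLp) ∧ ∀ x ∈ A, x ∉ U → β x.ofLp = 0) ?_ ?_ ?_ ?_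
  · exact ⟨fun _ => 0, IsNetFun.const 0, fun _ => le_rfl, by simp, by simp⟩
  · rintro S T hST ⟨β, h1, h2, h3, h4⟩
    exact ⟨β, h1, h2, fun x hx => h3 x (hST hx), h4⟩
  · rintro S T ⟨β, h1, h2, h3, h4⟩ ⟨β', h1', h2', h3', h4'⟩
    refine ⟨fun x => β x + β' x, h1.add h1', fun x => add_nonneg (h2 x) (h2' x), ?_,
      fun x hx hxU => by simp [h4 x hx hxU, h4' x hx hxU]⟩
    rintro x (hx | hx)
    · linarith [h3 x hx, h2' x.ofLp]
    · linarith [h3' x hx, h2 x.ofLp]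
  · intro p hp
    obtain ⟨δ, hδ, hball⟩ := Metric.mem_nhdsWithin_iff.1 (hSU hp).2
    have hnorm : IsNetFun (fun x : Fin d → ℝ => ∑ i, max (x i - p i) (p i - x i)) :=
      IsNetFun.sum _ fun i => ((IsNetFun.coord i).sub (IsNetFun.const _)).sup
        ((IsNetFun.const _).sub (IsNetFun.coord i))
    have habs : ∀ x : Fin d → ℝ, ∑ i, max (x i - p i) (p i - x i) = ∑ i, |x i - p i| := fun x =>
      Finset.sum_congr rfl fun i _ => by rw [abs_eq_max_neg, neg_sub]
    refine ⟨{x | ∑ i, |x i - p i| < δ / 2}, mem_nhdsWithin_of_mem_nhds ?_,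
      -- At least `1` within $\ell^1$-distance `δ / 2` of `p`, and zero from distance `δ` on.
      fun x => max (2 - 2 / δ * ∑ i, max (x i - p i) (p i - x i)) 0,
      ((IsNetFun.const 2).sub (hnorm.smul _)).relu, fun x => le_max_right _ _, fun x hx => ?_,
      fun x hx hxU => max_eq_right ?_⟩
    · refine IsOpen.mem_nhds (isOpen_lt (by fun_prop) continuous_const) ?_
      simp [hδ]
    · refine le_max_of_le_left ?_
      have hx' : ∑ i, |x i - p i| < δ / 2 := hx
      rw [habs, div_mul_eq_mul_div, le_sub_comm, div_le_iff₀ hδ]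
      linarith
    · rw [habs, sub_nonpos, div_mul_eq_mul_div, le_div_iff₀ hδ]
      by_contra hlt
      refine hxU (hball ⟨?_, hx⟩)
      rw [Metric.mem_ball, dist_eq_norm]
      refine (EuclideanSpace.norm_le_sum_abs _).trans_lt ?_
      simp only [PiLp.sub_apply]
      linarith

/-- A network cutoff that separates a compact subset of the interior of `U` from `A \ U`. -/
theorem exists_isNetFun_cutoff {d : ℕ} {A U S : Set (EuclideanSpace ℝ (Fin d))} (hS : IsCompact S)
    (hSU : S ⊆ relInterior A U) : ∃ η : (Fin d → ℝ) → ℝ, IsNetFun η ∧ (∀ x, 0 ≤ η x) ∧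
      (∀ x ∈ S, η x.ofLp = 0) ∧ ∀ x ∈ A, x ∉ U → η x.ofLp = 1 := by
  obtain ⟨β, h1, h2, h3, h4⟩ := exists_isNetFun_bump hS hSU
  refine ⟨fun x => max (1 - β x) 0, ((IsNetFun.const 1).sub h1).relu, fun x => le_max_right _ _,
    fun x hx => max_eq_right (by linarith [h3 x hx]), fun x hx hxU => ?_⟩
  simp [h4 x hx hxU]

namespace IsNetFun

variable {κ : Type} [Fintype κ]

theorem exists_normNet_pi {J : Type} [Fintype J] {f : J → (κ → ℝ) → ℝ} (h : ∀ j, IsNetFun (f j)) :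
    ∃ w R L, 1 ≤ R ∧ NormNet w R L (fun x j => f j x) := by
  choose w R L hR hL h using fun j => (h j).exists_pos_depth
  have hR0 : ∀ j, 0 ≤ R j := fun j => zero_le_one.trans (hR j)
  refine ⟨_, 1 + ∑ j, R j, ∑ j, L j, by linarith [Finset.sum_nonneg fun j (_ : j ∈ Finset.univ) => hR0 j],
    NormNet.parallel_scalar fun j => ((h j).mono le_rfl ?_).depth_mono (hL j)
      (Finset.single_le_sum (f := L) (fun _ _ => Nat.zero_le _) (Finset.mem_univ j))⟩
  linarith [Finset.single_le_sum (f := R) (fun j _ => hR0 j) (Finset.mem_univ j)]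

theorem linear {d s : ℕ} (ζ : EuclideanSpace ℝ (Fin d) →ₗ[ℝ] EuclideanSpace ℝ (Fin s)) (i : Fin s) :
    IsNetFun (fun x : Fin d → ℝ => ζ (WithLp.toLp 2 x) i) := by
  have h : ∀ x : Fin d → ℝ, ζ (WithLp.toLp 2 x) i =
      ∑ k, ζ (EuclideanSpace.single k 1) i * x k := by
    intro x
    have hx : WithLp.toLp 2 x = ∑ k, x k • EuclideanSpace.single k (1 : ℝ) := by
      ext j
      simp [Finset.sum_apply, Pi.single_apply]
    rw [hx, map_sum]
    simp [mul_comm]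
  rw [funext h]
  exact IsNetFun.sum _ fun k => (IsNetFun.coord k).smul _

end IsNetFun

/-! ### One chart -/

/-- The constant in the approximation error on one chart. -/
noncomputable def chartConst (s r : ℕ) (ν B : ℝ) : ℝ :=
  s ^ r * B * s ^ (r + ν) + 2 ^ s * Fintype.card (MonoIndex s r) * B * r

theorem chartConst_nonneg {s r : ℕ} {ν B : ℝ} (hB : 0 ≤ B) : 0 ≤ chartConst s r ν B := by
  unfold chartConst; positivity

/-- The $(N+1)^s$ grid points use up $N^s$ of the accuracy $4^{-n}\le N^{-(s+r+1)}$; the rest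
$N^{-(r+1)}$ suffices as $\nu\le1$. -/
theorem network_error_le {s r N n : ℕ} {ν B : ℝ} (hN : 1 ≤ N) (hν1 : ν ≤ 1) (hB : 0 ≤ B)
    (hn : (N : ℝ) ^ (s + r + 1) ≤ 4 ^ n) :
    (N + 1 : ℝ) ^ s * Fintype.card (MonoIndex s r) * (B * (r * (1 / 4) ^ n)) ≤
      2 ^ s * Fintype.card (MonoIndex s r) * B * r * (N : ℝ) ^ (-(r + ν)) := by
  have hN' : (1 : ℝ) ≤ N := by exact_mod_cast hN
  have h1 : (N + 1 : ℝ) ^ s * (1 / 4) ^ n ≤ 2 ^ s * (N : ℝ) ^ (-(r + ν)) := by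
    have h2 : (N + 1 : ℝ) ^ s ≤ 2 ^ s * N ^ s := by
      rw [← mul_pow]; exact pow_le_pow_left₀ (by positivity) (by linarith) _
    have h3 : (N : ℝ) ^ s * (1 / 4) ^ n ≤ (N : ℝ) ^ (-(r + ν)) := by
      have h4 : ((N : ℝ) ^ (r + 1))⁻¹ ≤ (N : ℝ) ^ (-(r + ν)) := by
        rw [← Real.rpow_natCast, ← Real.rpow_neg (by positivity)]
        exact Real.rpow_le_rpow_of_exponent_le hN' (by push_cast; linarith)
      refine le_trans ?_ h4
      rw [one_div_pow, one_div, ← div_eq_mul_inv, div_le_iff₀ (by positivity), inv_mul_eq_div,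
        le_div_iff₀ (by positivity), ← pow_add]
      simpa [add_assoc] using hn
    calc (N + 1 : ℝ) ^ s * (1 / 4) ^ n ≤ 2 ^ s * N ^ s * (1 / 4) ^ n := by gcongr
      _ = 2 ^ s * (N ^ s * (1 / 4) ^ n) := by ring
      _ ≤ _ := by gcongr
  calc (N + 1 : ℝ) ^ s * Fintype.card (MonoIndex s r) * (B * (r * (1 / 4) ^ n)) =
        Fintype.card (MonoIndex s r) * B * r * ((N + 1 : ℝ) ^ s * (1 / 4) ^ n) := by ring
    _ ≤ Fintype.card (MonoIndex s r) * B * r * (2 ^ s * (N : ℝ) ^ (-(r + ν))) := by gcongr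
    _ = _ := by ring

section Chart

variable {s r N n : ℕ} {ν B η : ℝ} {g : EuclideanSpace ℝ (Fin s) → ℝ} {y : EuclideanSpace ℝ (Fin s)}

theorem abs_gridApprox_taylorCoeff_sub_le (hN : 1 ≤ N) (hν : 0 < ν) (hν1 : ν ≤ 1)
    (hB : 0 ≤ B) (hn : (N : ℝ) ^ (s + r + 1) ≤ 4 ^ n) (hg : ContDiffOn ℝ r g (unitCube s))
    (hgB : ∀ k ≤ r, ∀ t : Fin k → Fin s, ∀ y ∈ unitCube s, |cubePartial t g y| ≤ B)
    (hH : ∀ t : Fin r → Fin s, ∀ y ∈ unitCube s, ∀ z ∈ unitCube s,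
      |cubePartial t g y - cubePartial t g z| ≤ B * ‖y - z‖ ^ ν)
    (hy : y ∈ unitCube s) (hη : 0 ≤ η) (hgη : η = 0 ∨ g y = 0) :
    |gridApprox N n (taylorCoeff r N g) (fun o => o.elim η y) - g y| ≤
      chartConst s r ν B * (N : ℝ) ^ (-(r + ν)) := by
  have h1 := abs_gridApprox_sub_le (n := n) (z := fun o => o.elim η y) hN hη hB
    (abs_taylorCoeff_le (N := N) hgB)
  have h2 := abs_sum_nodeWeight_taylor_sub_le hN hν hB hg hH hy hη hgη
  have h3 := network_error_le (r := r) (s := s) (n := n) hN hν1 hB hn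
  have h4 : (s / N : ℝ) ^ (r + ν) = s ^ (r + ν) * (N : ℝ) ^ (-(r + ν)) := by
    rw [Real.div_rpow (by positivity) (by positivity), Real.rpow_neg (by positivity), div_eq_mul_inv]
  rw [h4] at h2
  refine (abs_sub_le _ _ _).trans ((add_le_add (h1.trans h3) h2).trans (le_of_eq ?_))
  rw [chartConst]
  ring

/-- Off the chart the cutoff kills every weight, so only the multiplication error remains; `y` need
not lie in the cube. -/
theorem abs_gridApprox_taylorCoeff_le (hN : 1 ≤ N) (hν1 : ν ≤ 1)
    (hB : 0 ≤ B) (hn : (N : ℝ) ^ (s + r + 1) ≤ 4 ^ n)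
    (hgB : ∀ k ≤ r, ∀ t : Fin k → Fin s, ∀ y ∈ unitCube s, |cubePartial t g y| ≤ B)
    (hη : 1 ≤ η) :
    |gridApprox N n (taylorCoeff r N g) (fun o => o.elim η y)| ≤
      chartConst s r ν B * (N : ℝ) ^ (-(r + ν)) := by
  have h1 := abs_gridApprox_sub_le (n := n) (z := fun o => o.elim η y) hN
    (zero_le_one.trans hη : (0 : ℝ) ≤ η) hB (abs_taylorCoeff_le (N := N) hgB)
  rw [Finset.sum_eq_zero fun m _ => by
    rw [nodeWeight_of_one_le (z := zoom N m fun o => o.elim η y) hη, zero_mul], sub_zero] at h1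
  refine (h1.trans (network_error_le hN hν1 hB hn)).trans ?_
  rw [chartConst]
  gcongr
  exact le_add_of_nonneg_left (by positivity)

end Chart

/-! ### Choice of the parameters -/

/-- Ensures `n ≤ N` for $n=q(\lfloor\log_2N\rfloor+1)$. -/
theorem exists_forall_mul_log_le (q : ℕ) : ∃ N₀ : ℕ, ∀ N ≥ N₀, q * (Nat.log 2 N + 1) ≤ N := by
  have h := tendsto_pow_const_div_const_pow_of_one_lt 1 (one_lt_two : (1 : ℝ) < 2)
  obtain ⟨k₀, hk⟩ := Filter.eventually_atTop.1
    (h.eventually_lt_const (u := 1 / (2 * (q : ℝ) + 1)) (by positivity))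
  refine ⟨2 ^ (k₀ + 1), fun N hN => ?_⟩
  have hN0 : N ≠ 0 := by have := Nat.one_le_two_pow (n := k₀ + 1); omega
  have h1 : k₀ + 1 ≤ Nat.log 2 N := (Nat.le_log_iff_pow_le one_lt_two hN0).2 hN
  have h2 := hk (Nat.log 2 N) (by omega)
  rw [pow_one, div_lt_div_iff₀ (by positivity) (by positivity), one_mul] at h2
  have h3 : Nat.log 2 N * (2 * q + 1) < 2 ^ Nat.log 2 N := by exact_mod_cast h2
  have h4 := Nat.pow_log_le_self 2 hN0
  nlinarith

theorem pow_le_four_pow_log (q N : ℕ) : (N : ℝ) ^ q ≤ 4 ^ (q * (Nat.log 2 N + 1)) := by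
  have h1 : (N : ℝ) ≤ 2 ^ (Nat.log 2 N + 1) := by
    exact_mod_cast (Nat.lt_pow_succ_log_self one_lt_two N).le
  calc (N : ℝ) ^ q ≤ (2 ^ (Nat.log 2 N + 1)) ^ q := pow_le_pow_left₀ (by positivity) h1 _
    _ ≤ (4 ^ (Nat.log 2 N + 1)) ^ q := by gcongr; norm_num
    _ = _ := by rw [← pow_mul, mul_comm]

theorem natLog_add_one_le {N : ℕ} {M : ℝ} (hN : 1 ≤ N) (hNM : (N : ℝ) ≤ M)
    (hM : 1 ≤ Real.log M) : ((Nat.log 2 N + 1 : ℕ) : ℝ) ≤ 3 * Real.log M := by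
  have h1 : ((2 : ℝ) ^ Nat.log 2 N) ≤ M :=
    le_trans (by exact_mod_cast Nat.pow_log_le_self 2 (by omega)) hNM
  have h2 := Real.log_le_log (by positivity) h1
  rw [Real.log_pow] at h2
  have h3 := Real.log_two_gt_d9
  push_cast
  nlinarith [(Nat.log 2 N).cast_nonneg (α := ℝ)]

theorem exists_grid_size {s : ℕ} {Q τ M N₀ : ℝ} (hQ : 1 ≤ Q) (hτ : 0 ≤ τ) (hN₀ : 0 ≤ N₀)
    (hM : Q * (N₀ + 1) ^ (s + 1) ≤ M) : ∃ N : ℕ, 1 ≤ N ∧ N₀ ≤ N ∧ Q * (N : ℝ) ^ (s + 1) ≤ M ∧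
      (N : ℝ) ^ s ≤ M ^ ((s : ℝ) / (s + 1)) ∧ (N : ℝ) ≤ M ∧
      (N : ℝ) ^ (-τ) ≤ 2 ^ τ * Q ^ (τ / (s + 1)) * M ^ (-τ / (s + 1)) := by
  have hQ0 : 0 < Q := by linarith
  have h1 : (1 : ℝ) ≤ (N₀ + 1) ^ (s + 1) := one_le_pow₀ (by linarith)
  have hM1 : 1 ≤ M := by nlinarith
  have hM0 : 0 < M := by linarith
  have hs : (0 : ℝ) < s + 1 := by positivity
  -- The real solution of $Q\rho^{s+1}=M$; the grid size is its integer part.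
  set ρ : ℝ := (M / Q) ^ ((1 : ℝ) / (s + 1)) with hρ
  have hρ0 : 0 ≤ ρ := by positivity
  have hρpow : ρ ^ (s + 1) = M / Q := by
    rw [hρ, ← Real.rpow_natCast, ← Real.rpow_mul (by positivity)]
    push_cast
    rw [one_div_mul_cancel hs.ne', Real.rpow_one]
  have hρN : N₀ + 1 ≤ ρ := by
    refine le_of_pow_le_pow_left₀ (n := s + 1) (by omega) hρ0 ?_
    rw [hρpow, le_div_iff₀ hQ0, mul_comm]
    exact hM
  have hfl : (⌊ρ⌋₊ : ℝ) ≤ ρ := Nat.floor_le hρ0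
  have hfl' : ρ < ⌊ρ⌋₊ + 1 := Nat.lt_floor_add_one ρ
  have hN1 : 1 ≤ ⌊ρ⌋₊ := Nat.le_floor (by push_cast; linarith)
  have hN1' : (1 : ℝ) ≤ (⌊ρ⌋₊ : ℝ) := by exact_mod_cast hN1
  have hpow : Q * (⌊ρ⌋₊ : ℝ) ^ (s + 1) ≤ M := by
    rw [mul_comm, ← le_div_iff₀ hQ0, ← hρpow]
    gcongr
  have hpow' : (⌊ρ⌋₊ : ℝ) ^ (s + 1) ≤ M := by nlinarith [one_le_pow₀ (n := s + 1) hN1']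
  refine ⟨⌊ρ⌋₊, hN1, by linarith, hpow, ?_, ?_, ?_⟩
  · have h2 := Real.rpow_le_rpow (by positivity) hpow' (by positivity : (0 : ℝ) ≤ s / (s + 1))
    refine le_trans (le_of_eq ?_) h2
    rw [← Real.rpow_natCast, ← Real.rpow_natCast, ← Real.rpow_mul (by positivity)]
    congr 1
    push_cast
    field_simp
  · exact (le_self_pow₀ hN1' (by omega)).trans hpow'
  · have h2 : ρ / 2 ≤ ⌊ρ⌋₊ := by linarith
    have h3 : 0 < ρ := by linarith
    calc (⌊ρ⌋₊ : ℝ) ^ (-τ) ≤ (ρ / 2) ^ (-τ) :=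
          Real.rpow_le_rpow_of_nonpos (by positivity) h2 (by linarith)
      _ = 2 ^ τ * ρ ^ (-τ) := by
          rw [Real.div_rpow h3.le (by norm_num), Real.rpow_neg (by norm_num : (0 : ℝ) ≤ 2), div_inv_eq_mul,
            mul_comm]
      _ = _ := by
          rw [hρ, ← Real.rpow_mul (by positivity), Real.div_rpow hM0.le hQ0.le, mul_assoc]
          congr 1
          rw [show (1 : ℝ) / (s + 1) * -τ = -(τ / (s + 1)) by ring, Real.rpow_neg hQ0.le,
            div_inv_eq_mul, mul_comm, neg_div]

/-! ### The network on all charts -/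

theorem norm_le_sqrt_mul {K : ℕ} {v : EuclideanSpace ℝ (Fin K)} {e : ℝ} (he : 0 ≤ e)
    (hv : ∀ i, |v i| ≤ e) : ‖v‖ ≤ √K * e := by
  rw [EuclideanSpace.norm_eq, Real.sqrt_le_left (by positivity), mul_pow, Real.sq_sqrt (by positivity)]
  refine (Finset.sum_le_card_nsmul _ _ (e ^ 2) fun i _ => ?_).trans (by simp)
  rw [Real.norm_eq_abs]
  exact pow_le_pow_left₀ (abs_nonneg _) (hv i) 2

theorem eLpNorm_restrict_le {X E : Type*} [MeasurableSpace X] [NormedAddCommGroup E]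
    {μ : Measure X} {A : Set X} (hA : MeasurableSet A) (hμ : μ A < ⊤) {f : X → E} {e : ℝ}
    (he : ∀ x ∈ A, ‖f x‖ ≤ e) :
    eLpNorm f 2 (μ.restrict A) ≤ ENNReal.ofReal (√(μ.real A) * e) := by
  refine (eLpNorm_le_of_ae_bound ((ae_restrict_iff' hA).2 (ae_of_all _ he))).trans (le_of_eq ?_)
  rw [Measure.restrict_apply_univ, ENNReal.ofReal_mul (by positivity), Real.sqrt_eq_rpow,
    ← ENNReal.ofReal_rpow_of_nonneg (by positivity) (by norm_num), Measure.real,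
    ENNReal.ofReal_toReal hμ.ne]
  norm_num

theorem chart_error_le {d s K r N n : ℕ} {ν B : ℝ} {A U S : Set (EuclideanSpace ℝ (Fin d))}
    {ζ : EuclideanSpace ℝ (Fin d) →ₗ[ℝ] EuclideanSpace ℝ (Fin s)} (hζ : BijOn ζ U (unitCube s))
    {κ : EuclideanSpace ℝ (Fin d) → EuclideanSpace ℝ (Fin K)}
    (hκ : κ ∘ Function.invFunOn ζ U ∈ holderClass r ν s K B) (hκS : ∀ x ∈ U, x ∉ S → κ x = 0)
    {η : (Fin d → ℝ) → ℝ} (hη : ∀ x, 0 ≤ η x) (hηS : ∀ x ∈ S, η x.ofLp = 0)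
    (hηU : ∀ x ∈ A, x ∉ U → η x.ofLp = 1) (hN : 1 ≤ N) (hν : 0 < ν) (hν1 : ν ≤ 1)
    (hn : (N : ℝ) ^ (s + r + 1) ≤ 4 ^ n) (hB : 0 ≤ B) (i : Fin K)
    {x : EuclideanSpace ℝ (Fin d)} (hx : x ∈ A) :
    |gridApprox N n (taylorCoeff r N fun y => (κ ∘ Function.invFunOn ζ U) y i)
        (fun o => o.elim (η x.ofLp) (ζ x)) - U.indicator κ x i| ≤
      chartConst s r ν B * (N : ℝ) ^ (-(r + ν)) := by
  obtain ⟨h1, h2, h3⟩ := hκ i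
  by_cases hxU : x ∈ U
  · have h4 : (κ ∘ Function.invFunOn ζ U) (ζ x) i = κ x i := by
      rw [Function.comp, hζ.injOn.leftInvOn_invFunOn hxU]
    rw [indicator_of_mem hxU, ← h4]
    refine abs_gridApprox_taylorCoeff_sub_le hN hν hν1 hB hn h1 h2 h3 (hζ.mapsTo hxU) (hη _) ?_
    by_cases hxS : x ∈ S
    · exact Or.inl (hηS x hxS)
    · right
      rw [h4, hκS x hxU hxS]
      rfl
  · rw [indicator_of_notMem hxU]
    simp only [PiLp.zero_apply, sub_zero]
    exact abs_gridApprox_taylorCoeff_le hN hν1 hB hn h2 (hηU x hx hxU).ge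

theorem holderClass_mono {r s K : ℕ} {ν B B' : ℝ} (h : B ≤ B') :
    holderClass r ν s K B ⊆ holderClass r ν s K B' := fun F hF i => by
  obtain ⟨h1, h2, h3⟩ := hF i
  exact ⟨h1, fun k hk t y hy => (h2 k hk t y hy).trans h, fun t y hy z hz =>
    (h3 t y hy z hz).trans (mul_le_mul_of_nonneg_right h (by positivity))⟩

theorem mainTheorem5 (s : ℕ) (hs : 0 < s) (r : ℕ) (ν : ℝ) (hν : 0 < ν) (hν1 : ν ≤ 1)
    (τ : ℝ) (hτ : τ = r + ν) (B : ℝ) :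
    ∃ c₁ > (0 : ℝ), ∃ c₂ > (0 : ℝ),
    ∀ (d C : ℕ), s < d → 0 < C →
    ∀ (A : Set (EuclideanSpace ℝ (Fin d))) (U : Fin C → Set (EuclideanSpace ℝ (Fin d)))
      (ζ : Fin C → EuclideanSpace ℝ (Fin d) →ₗ[ℝ] EuclideanSpace ℝ (Fin s)),
    IsLinearlyCharted A U ζ →
    -- fixed compact sets in the relative interiors of the `U j`; where `U j` is compact and
    -- relatively open one may take `S j = U j`
    ∀ S : Fin C → Set (EuclideanSpace ℝ (Fin d)),
    (∀ j, IsCompact (S j) ∧ S j ⊆ relInterior A (U j)) →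
    ∃ c₃ > (0 : ℝ), ∀ K : ℕ, ∃ M₀ > (0 : ℝ),
    ∀ κ : Fin C → EuclideanSpace ℝ (Fin d) → EuclideanSpace ℝ (Fin K),
    (∀ j, κ j ∘ Function.invFunOn (ζ j) (U j) ∈ holderClass r ν s K B) →
    (∀ j, ∀ x ∈ U j, x ∉ S j → κ j x = 0) →
    ∀ M : ℝ, M₀ ≤ M → ∀ W D : ℕ,
    c₁ * (C * M ^ ((s : ℝ) / (s + 1)) * Real.log M) ≤ W →
    c₂ * Real.log M ≤ D →
    ∃ f ∈ reluClass d K W D (C * M),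
      eLpNorm (fun x => f x - ∑ j, (U j).indicator (κ j) x) 2
          ((Measure.hausdorffMeasure (s : ℝ)).restrict A) ≤
        ENNReal.ofReal (c₃ * (Real.sqrt K * M ^ (-τ / (s + 1)))) := by
  obtain ⟨c, hc, hnet⟩ := exists_normNet_gridApprox s r
  set q := s + r + 1 with hq
  set B₁ := max B 1 with hB₁
  have hB1 : 1 ≤ B₁ := le_max_right _ _
  have hB0 : 0 ≤ B₁ := by linarith
  have hc' : (1 : ℝ) ≤ c := by exact_mod_cast hc
  have hcpos : (0 : ℝ) < c := by linarith
  -- The factor `3 * q` comes from $n\le3q\log M$, $2^s$ from $(N+1)^s\le2^sN^s$, and `+ 1` leaves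
  -- room for the depth of the input network.
  refine ⟨3 * c * q * 2 ^ s, by positivity, 3 * c * q + 1, by positivity, ?_⟩
  intro d C _ hC A U ζ hchart S hS
  have hC' : (1 : ℝ) ≤ C := by exact_mod_cast hC
  choose η hηnet hη0 hηS hηU using fun j => exists_isNetFun_cutoff (hS j).1 (hS j).2
  have hstage : ∀ p : Fin C × Option (Fin s), IsNetFun (fun x : Fin d → ℝ =>
      p.2.elim (η p.1 x) (ζ p.1 (WithLp.toLp 2 x)).ofLp) := by
    rintro ⟨j, _ | i⟩
    · exact hηnet j
    · exact IsNetFun.linear (ζ j) i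
  obtain ⟨w₁, R₁, L₁, hR₁, hnet₁⟩ := IsNetFun.exists_normNet_pi hstage
  set E := chartConst s r ν B₁ with hE
  have hE0 : 0 ≤ E := chartConst_nonneg hB0
  -- Chosen so that the whole network has norm at most $C\,Q\,N^{s+1}$.
  set Q : ℝ := R₁ * (c * 2 ^ s * B₁) with hQdef
  have h2s : (1 : ℝ) ≤ 2 ^ s := one_le_pow₀ one_le_two
  have hQ : 1 ≤ Q := by
    have h1 : (1 : ℝ) ≤ c * 2 ^ s := one_le_mul_of_one_le_of_one_le hc' h2s
    exact one_le_mul_of_one_le_of_one_le hR₁ (one_le_mul_of_one_le_of_one_le h1 hB1)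
  have hτ0 : 0 ≤ τ := by rw [hτ]; positivity
  obtain ⟨N₀, hN₀⟩ := exists_forall_mul_log_le q
  have hμ := hausdorffMeasure_lt_top_of_isEmbeddedManifold hchart.isCompact hchart.isEmbeddedManifold
  set v := √((Measure.hausdorffMeasure (s : ℝ) : Measure (EuclideanSpace ℝ (Fin d))).real A) with hv
  set G : ℝ := v * (C * E * (2 ^ τ * Q ^ (τ / (s + 1)))) with hG
  have hG0 : 0 ≤ G := by positivity
  -- The `+ 1` makes $c_3$ positive. The exponential in $M_0$ makes $\log M$ exceed the width and
  -- depth of the input network.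
  refine ⟨G + 1, by linarith, fun K => ⟨Q * (N₀ + 1) ^ (s + 1) + Real.exp (w₁ + L₁ + 1),
    by positivity, ?_⟩⟩
  intro κ hκ hκS M hM W D hW hD
  have hκ' := fun j => holderClass_mono (le_max_left B 1) (hκ j)
  have hMQ : Q * (N₀ + 1) ^ (s + 1) ≤ M := by linarith [Real.exp_pos (w₁ + L₁ + 1 : ℝ)]
  have hMexp : Real.exp (w₁ + L₁ + 1) ≤ M := by
    have : 0 ≤ Q * ((N₀ : ℝ) + 1) ^ (s + 1) := by positivity
    linarith
  have hM0 : 0 < M := (Real.exp_pos _).trans_le hMexp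
  have hlog : (w₁ : ℝ) + L₁ + 1 ≤ Real.log M := (Real.le_log_iff_exp_le hM0).2 hMexp
  have hw0 : (0 : ℝ) ≤ w₁ := Nat.cast_nonneg _
  have hL0 : (0 : ℝ) ≤ L₁ := Nat.cast_nonneg _
  obtain ⟨N, hN1, hNN₀, hNQ, hNs, hNM, hNτ⟩ := exists_grid_size hQ hτ0 (Nat.cast_nonneg N₀) hMQ
  set n := q * (Nat.log 2 N + 1) with hn
  have hnN : n ≤ N := hN₀ N (by exact_mod_cast hNN₀)
  have hn1 : 1 ≤ n := Nat.mul_pos (by omega) (by omega)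
  have hNn : (N : ℝ) ^ (s + r + 1) ≤ 4 ^ n := pow_le_four_pow_log q N
  have hN1' : (1 : ℝ) ≤ N := by exact_mod_cast hN1
  have hnlog : (n : ℝ) ≤ 3 * q * Real.log M := by
    have := natLog_add_one_le hN1 hNM (by linarith)
    rw [hn, Nat.cast_mul]
    nlinarith [(q.cast_nonneg : (0 : ℝ) ≤ q)]
  have hN2 : (N + 1 : ℝ) ^ s ≤ 2 ^ s * N ^ s := by
    rw [← mul_pow]; exact pow_le_pow_left₀ (by positivity) (by linarith) _
  have hM1 : (1 : ℝ) ≤ M ^ ((s : ℝ) / (s + 1)) := Real.one_le_rpow (hN1'.trans hNM) (by positivity)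
  -- the network
  set a : Fin C → Fin K → (Fin s → Fin (N + 1)) → MonoIndex s r → ℝ := fun j i =>
    taylorCoeff r N fun y => (κ j ∘ Function.invFunOn (ζ j) (U j)) y i with ha
  set z : Fin C → (Fin d → ℝ) → Option (Fin s) → ℝ := fun j x o =>
    o.elim (η j x) (ζ j (WithLp.toLp 2 x)).ofLp with hz
  have hnet₂ : ∀ j, NormNet (c * n * (N + 1) ^ s) (c * N * (N + 1) ^ s * B₁) (c * n)
      (fun (x : Fin C × Option (Fin s) → ℝ) i => gridApprox N n (a j i) fun o => x (j, o)) :=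
    fun j => (hnet N n hn1 hnN K B₁ hB0 (a j) fun i m t =>
      abs_taylorCoeff_le (hκ' j i).2.1 m t).select (Prod.mk j)
  -- Adding the charts multiplies the norm by `C`, which the budget $CM$ allows.
  have hnet₃ := (NormNet.parallel hnet₂).post_affine (o := Fin K)
    (R' := C * (c * N * (N + 1) ^ s * B₁)) (fun i p => if p.2 = i then 1 else 0) 0 (fun i => by
      have : ∑ p : (Σ _ : Fin C, Fin K), |if p.2 = i then (1 : ℝ) else 0| = C := by
        rw [Fintype.sum_sigma]
        simp [apply_ite abs]
      rw [this]
      simp)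
  have hWle : C * (c * n * (N + 1) ^ s) ≤ W ∧ w₁ ≤ W := by
    have h0 : (0 : ℝ) ≤ Real.log M := by linarith
    constructor
    · have h1 : (C : ℝ) * (c * n * (N + 1) ^ s) ≤ W := by
        calc (C : ℝ) * (c * n * (N + 1) ^ s) ≤
              C * (c * (3 * q * Real.log M) * (2 ^ s * M ^ ((s : ℝ) / (s + 1)))) := by
              gcongr
              exact hN2.trans (by gcongr)
          _ = 3 * c * q * 2 ^ s * (C * M ^ ((s : ℝ) / (s + 1)) * Real.log M) := by ring
          _ ≤ W := hW
      exact_mod_cast h1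
    · have hq1 : (1 : ℝ) ≤ q := by exact_mod_cast (by omega : 1 ≤ q)
      have h1 : (1 : ℝ) ≤ 3 * c * q * 2 ^ s :=
        one_le_mul_of_one_le_of_one_le (one_le_mul_of_one_le_of_one_le (by linarith) hq1) h2s
      have h2 : (1 : ℝ) ≤ C * M ^ ((s : ℝ) / (s + 1)) := one_le_mul_of_one_le_of_one_le hC' hM1
      have h3 : (w₁ : ℝ) ≤ W := by
        calc (w₁ : ℝ) ≤ Real.log M := by linarith
          _ ≤ C * M ^ ((s : ℝ) / (s + 1)) * Real.log M := le_mul_of_one_le_left h0 h2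
          _ ≤ 3 * c * q * 2 ^ s * (C * M ^ ((s : ℝ) / (s + 1)) * Real.log M) :=
            le_mul_of_one_le_left (by positivity) h1
          _ ≤ W := hW
      exact_mod_cast h3
  have hDle : c * n + L₁ ≤ D := by
    have h1 : ((c * n + L₁ : ℕ) : ℝ) ≤ D := by
      push_cast
      calc (c : ℝ) * n + L₁ ≤ c * (3 * q * Real.log M) + Real.log M := by
            gcongr
            linarith
        _ = (3 * c * q + 1) * Real.log M := by ring
        _ ≤ D := hD
    exact_mod_cast h1
  have hcn : 0 < c * n := Nat.mul_pos hc hn1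
  have hRle : R₁ * (C * (c * N * (N + 1) ^ s * B₁)) ≤ C * M := by
    calc R₁ * (C * (c * N * (N + 1) ^ s * B₁)) ≤ R₁ * (C * (c * N * (2 ^ s * N ^ s) * B₁)) := by
          gcongr
      _ = C * (Q * N ^ (s + 1)) := by rw [hQdef]; ring
      _ ≤ C * M := by gcongr
  have hnet₄ := (((hnet₁.mono hWle.2 le_rfl).comp (hnet₃.mono (by simpa using hWle.1) le_rfl)
    hR₁).mono le_rfl hRle).depth_mono (by omega) hDle
  obtain ⟨Net, hNw, hNd, hNn', hNe⟩ := hnet₄.exists_reLUNet (by positivity)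
    (by omega : 0 < D)
  refine ⟨fun x => WithLp.toLp 2 (Net.eval x.ofLp), ⟨Net, hNw, hNd, hNn', fun x => rfl⟩, ?_⟩
  -- the error
  have herr : ∀ x ∈ A, ‖WithLp.toLp 2 (Net.eval x.ofLp) - ∑ j, (U j).indicator (κ j) x‖ ≤
      √K * (C * (E * (N : ℝ) ^ (-τ))) := by
    intro x hx
    refine norm_le_sqrt_mul (by positivity) fun i => ?_
    have h1 : Net.eval x.ofLp i = ∑ j, gridApprox N n (a j i) (z j x.ofLp) := by
      rw [← hNe]
      simp [Fintype.sum_sigma, hz]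
    have h2 : (WithLp.toLp 2 (Net.eval x.ofLp) - ∑ j, (U j).indicator (κ j) x) i =
        ∑ j, (gridApprox N n (a j i) (z j x.ofLp) - (U j).indicator (κ j) x i) := by
      rw [Finset.sum_sub_distrib, ← h1]
      simp
    rw [h2]
    refine (Finset.abs_sum_le_sum_abs _ _).trans
      ((Finset.sum_le_card_nsmul _ _ (E * (N : ℝ) ^ (-τ)) fun j _ => ?_).trans (by simp))
    rw [hτ]
    exact chart_error_le (hchart.bijOn j) (hκ' j) (hκS j) (hη0 j) (hηS j) (hηU j) hN1 hν hν1 hNn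
      hB0 i hx
  refine (eLpNorm_restrict_le hchart.isCompact.measurableSet hμ herr).trans
    (ENNReal.ofReal_le_ofReal ?_)
  calc v * (√K * (C * (E * (N : ℝ) ^ (-τ)))) ≤
        v * (√K * (C * (E * (2 ^ τ * Q ^ (τ / (s + 1)) * M ^ (-τ / (s + 1)))))) := by gcongr
    _ = G * (√K * M ^ (-τ / (s + 1))) := by rw [hG]; ring
    _ ≤ (G + 1) * (√K * M ^ (-τ / (s + 1))) := by gcongr; linarith
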